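/- Let $X$ be a complex Hilbert space with inner product $\langle\cdot|\cdot\rangle$ and norm $\|\cdot\|$, let $\varepsilon>0$, let $A_0$ be a densely defined self-adjoint operator in $X$ with $\langle\xi|A_0\xi\rangle\ge 0$ for all $\xi\in D(A_0)$, and let $A=A_0+\varepsilon$. Let $A^{1/2}$ be the positive self-adjoint square root of $A$. Let $B:D(A^{1/2})\to X$ be linear, either symmetric or bounded (with respect to $\|\cdot\|$), and such that for some $a\in[0,1)$ and $b\in\mathbb R$ $$\|B\xi\|^2\le a^2\|A^{1/2}\xi\|^2+b^2\|\xi\|^2\qquad(\xi\in D(A^{1/2})).$$ Put $\mu_B=0$ if $B$ is symmetric and $\mu_B=\|B\|$ (operator norm) otherwise. Let $C=-\varepsilon$ on $D(A^{1/2})$. Let $Y=D(A^{1/2})\times X$ with the inner product $(\xi|\eta)=\langle A^{1/2}\xi_1|A^{1/2}\eta_1\rangle+\langle\xi_2|\eta_2\rangle$, and let $|\cdot|$ denote the corresponding norm on $Y$ and the operator norm for bounded operators on $Y$. On $D(H)=D(A)\times D(A^{1/2})\subset Y$ put $$H\xi=(-i\xi_2,\,iA\xi_1),\quad \hat B\xi=(0,-B\xi_2),\quad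 V\xi=(0,iC\xi_1),\qquad G_+=-i(H+\hat B+V),\quad G_-=i(H+\hat B+V).$$ A strongly continuous semigroup $T:[0,\infty)\to L(Y,Y)$ is said to be generated by $G$ if, for $\xi,\eta\in Y$, one has $\xi\in D(G)$ and $G\xi=\eta$ if and only if $\lim_{t\to0+}t^{-1}(\xi-T(t)\xi)=\eta$ (so, formally, $T(t)=\exp(-tG)$). Then $G_+$ and $G_-$ generate strongly continuous semigroups $T_+$ and $T_-$ on $Y$, and $$|T_\pm(t)|\le e\,\varepsilon^{1/2}\,t\,\exp(\mu_B t)\qquad\text{for all } t\ge\varepsilon^{-1/2}.$$ -/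

import Mathlib

open scoped NNReal Topology

noncomputable section

namespace AbstractWave

open Filter

variable {X : Type*} [NormedAddCommGroup X] [InnerProductSpace ℂ X]

/-- `⟨ξ, A ξ⟩ ≥ 0` for all `ξ` in the domain of `A`. -/
def IsNonneg (A : X →ₗ.[ℂ] X) : Prop :=
  ∀ ξ : A.domain, 0 ≤ (inner ℂ (ξ : X) (A ξ)).re

/-- The operator `A + c` with domain `D(A)`. -/
def addConst (A : X →ₗ.[ℂ] X) (c : ℝ) : X →ₗ.[ℂ] X where
  domain := A.domain
  toFun := A.toFun + (c : ℂ) • A.domain.subtype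

variable [CompleteSpace X]

/-- `A` is a (densely defined) self-adjoint operator with `⟨ξ, A ξ⟩ ≥ ε ⟨ξ, ξ⟩` on its domain,
where `ε > 0`. Self-adjointness of a partially defined operator includes that
its domain is dense. -/
structure IsStrictlyPositiveSA (A : X →ₗ.[ℂ] X) (ε : ℝ) : Prop where
  isSelfAdjoint : IsSelfAdjoint A
  eps_pos : 0 < ε
  lower_bound : ∀ ξ : A.domain, ε * ‖(ξ : X)‖ ^ 2 ≤ (inner ℂ (ξ : X) (A ξ)).re

/-- `S` is a positive self-adjoint operator with `S ∘ S = A`, domains included. -/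
structure IsPositiveSqrt (A S : X →ₗ.[ℂ] X) : Prop where
  isSelfAdjoint : IsSelfAdjoint S
  nonneg : IsNonneg S
  sq_eq : ∀ x y : X, (x, y) ∈ A.graph ↔ ∃ z : X, (x, z) ∈ S.graph ∧ (z, y) ∈ S.graph

section Sqrt

variable {A : X →ₗ.[ℂ] X} {ε : ℝ}

theorem IsStrictlyPositiveSA.norm_le (hA : IsStrictlyPositiveSA A ε) (ξ : A.domain) :
    ε * ‖(ξ : X)‖ ≤ ‖A ξ‖ := by
  have h1 := hA.lower_bound ξ
  have h2 : (inner ℂ (ξ : X) (A ξ)).re ≤ ‖(ξ : X)‖ * ‖A ξ‖ :=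
    (Complex.re_le_norm _).trans (norm_inner_le_norm _ _)
  rcases (norm_nonneg (ξ : X)).eq_or_lt with h | h
  · rw [← h, mul_zero]
    exact norm_nonneg _
  · nlinarith

theorem IsStrictlyPositiveSA.injective (hA : IsStrictlyPositiveSA A ε) :
    Function.Injective A.toFun := by
  rw [← LinearMap.ker_eq_bot, LinearMap.ker_eq_bot']
  intro ξ hξ
  have h1 := hA.norm_le ξ
  have h2 : A ξ = 0 := hξ
  rw [h2, norm_zero] at h1
  have h3 : ‖(ξ : X)‖ = 0 := by
    nlinarith [hA.eps_pos, norm_nonneg (ξ : X)]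
  exact Subtype.ext (norm_eq_zero.mp h3)

theorem IsStrictlyPositiveSA.formal (hA : IsStrictlyPositiveSA A ε) (x y : A.domain) :
    inner ℂ (A x) (y : X) = inner ℂ (x : X) (A y) := by
  have h := LinearPMap.adjoint_isFormalAdjoint hA.isSelfAdjoint.dense_domain
  rw [LinearPMap.isSelfAdjoint_def.mp hA.isSelfAdjoint] at h
  exact h x y

theorem mem_graph_of_isSelfAdjoint {S : X →ₗ.[ℂ] X} (hS : IsSelfAdjoint S) {v w : X}
    (h : ∀ x : S.domain, inner ℂ w (x : X) = inner ℂ v (S x)) : (v, w) ∈ S.graph := by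
  have hv : v ∈ S.adjoint.domain := LinearPMap.mem_adjoint_domain_of_exists v ⟨w, h⟩
  have hw : S.adjoint ⟨v, hv⟩ = w := LinearPMap.adjoint_apply_eq hS.dense_domain ⟨v, hv⟩ h
  have hmem : (v, w) ∈ S.adjoint.graph := by
    rw [LinearPMap.mem_graph_iff]
    exact ⟨⟨v, hv⟩, rfl, hw⟩
  rwa [LinearPMap.isSelfAdjoint_def.mp hS] at hmem

theorem IsStrictlyPositiveSA.surjective (hA : IsStrictlyPositiveSA A ε) :
    Function.Surjective A.toFun := by
  have hε := hA.eps_pos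
  have hclosed : IsClosed (A.graph : Set (X × X)) := hA.isSelfAdjoint.isClosed
  have : CompleteSpace A.graph := hclosed.completeSpace_coe
  let g : A.graph →L[ℂ] X := (ContinuousLinearMap.snd ℂ X X).comp A.graph.subtypeL
  have hg : AntilipschitzWith (Real.toNNReal (max ε⁻¹ 1)) g := by
    refine g.antilipschitz_of_bound ?_
    rintro ⟨⟨x, y⟩, hxy⟩
    obtain ⟨ξ, h1, h2⟩ := LinearPMap.mem_graph_iff _ |>.mp hxy
    simp only at h1 h2
    have h3 := hA.norm_le ξ
    rw [h1, h2] at h3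
    have h4 : ‖x‖ ≤ ε⁻¹ * ‖y‖ := by
      rw [inv_mul_eq_div, le_div_iff₀ hε]
      linarith
    rw [Real.coe_toNNReal _ (le_trans zero_le_one (le_max_right _ _))]
    change max ‖x‖ ‖y‖ ≤ max ε⁻¹ 1 * ‖y‖
    refine max_le (h4.trans ?_) ?_
    · exact mul_le_mul_of_nonneg_right (le_max_left _ _) (norm_nonneg _)
    · calc ‖y‖ = 1 * ‖y‖ := (one_mul _).symm
        _ ≤ _ := mul_le_mul_of_nonneg_right (le_max_right _ _) (norm_nonneg _)
  have hrange : IsClosed (Set.range g) := hg.isClosed_range g.uniformContinuous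
  have hreq : Set.range g = (LinearMap.range A.toFun : Set X) := by
    ext y
    constructor
    · rintro ⟨⟨⟨x, y'⟩, hxy⟩, rfl⟩
      obtain ⟨ξ, h1, h2⟩ := LinearPMap.mem_graph_iff _ |>.mp hxy
      exact ⟨ξ, h2⟩
    · rintro ⟨ξ, rfl⟩
      exact ⟨⟨((ξ : X), A ξ), A.mem_graph ξ⟩, rfl⟩
  rw [hreq] at hrange
  have : CompleteSpace (LinearMap.range A.toFun) := hrange.completeSpace_coe
  rw [← LinearMap.range_eq_top, ← Submodule.orthogonal_eq_bot_iff, Submodule.eq_bot_iff]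
  intro v hv
  have h0 : (v, (0 : X)) ∈ A.graph := by
    refine mem_graph_of_isSelfAdjoint hA.isSelfAdjoint fun x => ?_
    rw [inner_zero_left]
    exact (Submodule.mem_orthogonal' _ _ |>.mp hv _ ⟨x, rfl⟩).symm
  obtain ⟨ξ, h1, h2⟩ := LinearPMap.mem_graph_iff _ |>.mp h0
  simp only at h1 h2
  have h3 : ξ = 0 := hA.injective (by rw [map_zero]; exact h2)
  rw [← h1, h3]
  rfl

/-- A strictly positive self-adjoint operator has a positive self-adjoint square root. -/
theorem IsStrictlyPositiveSA.exists_sqrt (hA : IsStrictlyPositiveSA A ε) :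
    ∃ S : X →ₗ.[ℂ] X, IsPositiveSqrt A S := by
  have hε := hA.eps_pos
  let e : A.domain ≃ₗ[ℂ] X := LinearEquiv.ofBijective A.toFun ⟨hA.injective, hA.surjective⟩
  have he : ∀ y, A (e.symm y) = y := fun y => e.apply_symm_apply y
  let R : X →L[ℂ] X := LinearMap.mkContinuous (A.domain.subtype ∘ₗ e.symm.toLinearMap) ε⁻¹ (by
    intro y
    have h := hA.norm_le (e.symm y)
    rw [he] at h
    rw [inv_mul_eq_div, le_div_iff₀ hε]
    change ‖((e.symm y : A.domain) : X)‖ * ε ≤ ‖y‖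
    linarith)
  have hR : ∀ y, R y = ((e.symm y : A.domain) : X) := fun y => rfl
  have hRpos : 0 ≤ R := by
    rw [ContinuousLinearMap.nonneg_iff_isPositive, ContinuousLinearMap.isPositive_def]
    refine ⟨fun x y => ?_, fun y => ?_⟩
    · change inner ℂ (R x) y = inner ℂ x (R y)
      have := hA.formal (e.symm x) (e.symm y)
      rw [he, he] at this
      rw [hR, hR, this]
    · change 0 ≤ (inner ℂ (R y) y).re
      have h := hA.lower_bound (e.symm y)
      rw [he] at h
      rw [hR]
      exact le_trans (by positivity) h
  let Q : X →L[ℂ] X := CFC.sqrt R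
  have hQpos : Q.IsPositive :=
    (ContinuousLinearMap.nonneg_iff_isPositive Q).mp (CFC.sqrt_nonneg R)
  have hQQ : ∀ x, Q (Q x) = R x := fun x => by
    have : Q * Q = R := CFC.sqrt_mul_sqrt_self R hRpos
    rw [← this]
    rfl
  have hQsymm : ∀ x y, inner ℂ (Q x) y = inner ℂ x (Q y) := fun x y => hQpos.isSymmetric x y
  have hQinj : ∀ x, Q x = 0 → x = 0 := by
    intro x hx
    have h1 : R x = 0 := by rw [← hQQ, hx, map_zero]
    rw [hR] at h1
    have h2 : e.symm x = 0 := Subtype.ext h1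
    simpa using h2
  let f : X →ₗ.[ℂ] X := Q.toLinearMap.toPMap ⊤
  have hf : f.toFun.ker = ⊥ := by
    rw [LinearMap.ker_eq_bot']
    rintro ⟨x, hx⟩ h
    exact Subtype.ext (hQinj x h)
  let S : X →ₗ.[ℂ] X := f.inverse
  have hSg : ∀ x y, (x, y) ∈ S.graph ↔ Q y = x := by
    intro x y
    change (x, y) ∈ f.inverse.graph ↔ _
    rw [LinearPMap.inverse_graph hf, Submodule.mem_map]
    constructor
    · rintro ⟨⟨a, b⟩, hab, h⟩
      obtain ⟨z, h1, h2⟩ := LinearPMap.mem_graph_iff _ |>.mp hab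
      simp only [LinearEquiv.coe_coe, LinearEquiv.prodComm_apply, Prod.swap_prod_mk,
        Prod.mk.injEq] at h
      obtain ⟨rfl, rfl⟩ := h
      simp only at h1 h2
      rw [← h2, ← h1]
      rfl
    · rintro rfl
      exact ⟨(y, Q y), LinearPMap.mem_graph_iff _ |>.mpr ⟨⟨y, trivial⟩, rfl, rfl⟩, rfl⟩
  have hSdom : ∀ x, x ∈ S.domain ↔ ∃ y, Q y = x := by
    intro x
    rw [LinearPMap.mem_domain_iff]
    simp only [hSg]
  have hSdense : Dense (S.domain : Set X) := by
    rw [Submodule.dense_iff_topologicalClosure_eq_top,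
      Submodule.topologicalClosure_eq_top_iff, Submodule.eq_bot_iff]
    intro v hv
    refine hQinj v (ext_inner_right ℂ fun y => ?_)
    rw [hQsymm, inner_zero_left]
    exact Submodule.mem_orthogonal' _ _ |>.mp hv _ ((hSdom _).mpr ⟨y, rfl⟩)
  have hQS : ∀ x : S.domain, Q (S x) = x := fun x => (hSg _ _).mp (S.mem_graph x)
  refine ⟨S, ⟨?_, ?_, ?_⟩⟩
  · rw [LinearPMap.isSelfAdjoint_def]
    refine le_antisymm ?_ ?_
    · refine LinearPMap.le_of_le_graph ?_
      rintro ⟨v, w⟩ hvw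
      obtain ⟨z, h1, h2⟩ := LinearPMap.mem_graph_iff _ |>.mp hvw
      simp only at h1 h2
      rw [hSg]
      refine ext_inner_right ℂ fun y => ?_
      have hmem : (Q y, y) ∈ S.graph := (hSg _ _).mpr rfl
      obtain ⟨x, h3, h4⟩ := LinearPMap.mem_graph_iff _ |>.mp hmem
      simp only at h3 h4
      have h5 := LinearPMap.adjoint_isFormalAdjoint hSdense z x
      rw [h1, h2, h3, h4] at h5
      rw [hQsymm, h5]
    · refine LinearPMap.IsFormalAdjoint.le_adjoint hSdense fun x y => ?_
      conv_lhs => rw [← hQS y]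
      conv_rhs => rw [← hQS x]
      rw [hQsymm]
  · intro ξ
    have h := hQpos.inner_nonneg_left (S ξ)
    rw [hQS] at h
    exact (Complex.nonneg_iff.mp h).1
  · intro x y
    simp only [hSg]
    constructor
    · intro h
      obtain ⟨ξ, h1, h2⟩ := LinearPMap.mem_graph_iff _ |>.mp h
      simp only at h1 h2
      refine ⟨Q y, ?_, rfl⟩
      rw [hQQ, hR, ← h1, ← h2]
      congr 1
      exact e.symm_apply_apply ξ
    · rintro ⟨z, h1, h2⟩
      rw [LinearPMap.mem_graph_iff]
      refine ⟨e.symm y, ?_, he y⟩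
      rw [← h1, ← h2, hQQ, hR]

end Sqrt

section Energy

variable {A : X →ₗ.[ℂ] X} {ε : ℝ} (hA : IsStrictlyPositiveSA A ε)

/-- The positive self-adjoint square root `A^{1/2}`. -/
def sqrtOp (hA : IsStrictlyPositiveSA A ε) : X →ₗ.[ℂ] X := hA.exists_sqrt.choose

theorem sqrtOp_spec : IsPositiveSqrt A (sqrtOp hA) := hA.exists_sqrt.choose_spec

theorem domain_le_sqrtOp_domain : A.domain ≤ (sqrtOp hA).domain := by
  intro x hx
  obtain ⟨z, hz, _⟩ := ((sqrtOp_spec hA).sq_eq x (A ⟨x, hx⟩)).mp (A.mem_graph ⟨x, hx⟩)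
  exact LinearPMap.mem_domain_iff.mpr ⟨z, hz⟩

theorem sqrtOp_injective : Function.Injective (sqrtOp hA).toFun := by
  rw [← LinearMap.ker_eq_bot, LinearMap.ker_eq_bot']
  intro ξ hξ
  have hS := sqrtOp_spec hA
  have h1 : ((ξ : X), (0 : X)) ∈ (sqrtOp hA).graph :=
    LinearPMap.mem_graph_iff _ |>.mpr ⟨ξ, rfl, hξ⟩
  have h2 : ((ξ : X), (0 : X)) ∈ A.graph :=
    (hS.sq_eq _ _).mpr ⟨0, h1, (sqrtOp hA).graph.zero_mem⟩
  obtain ⟨η, h3, h4⟩ := LinearPMap.mem_graph_iff _ |>.mp h2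
  simp only at h3 h4
  have h5 : η = 0 := hA.injective (by rw [map_zero]; exact h4)
  refine Subtype.ext ?_
  rw [← h3, h5]
  rfl

/-- The space `D(A^{1/2})`, to be equipped with the norm `‖A^{1/2} ξ‖`. -/
def FormDomain (hA : IsStrictlyPositiveSA A ε) : Type _ := (sqrtOp hA).domain

instance : AddCommGroup (FormDomain hA) := inferInstanceAs (AddCommGroup (sqrtOp hA).domain)

instance : Module ℂ (FormDomain hA) := inferInstanceAs (Module ℂ (sqrtOp hA).domain)

/-- The identity map from `D(A^{1/2})` with the energy norm to `D(A^{1/2})` as a subspace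
of `X`. -/
def FormDomain.toDomain : FormDomain hA ≃ₗ[ℂ] (sqrtOp hA).domain := LinearEquiv.refl ℂ _

/-- The map `A^{1/2} : D(A^{1/2}) → X`. -/
def FormDomain.sqrtMap : FormDomain hA →ₗ[ℂ] X :=
  (sqrtOp hA).toFun ∘ₗ (FormDomain.toDomain hA).toLinearMap

/-- The norm `‖A^{1/2} ξ‖` on `D(A^{1/2})`. -/
instance : NormedAddCommGroup (FormDomain hA) :=
  NormedAddCommGroup.induced (FormDomain hA) X (FormDomain.sqrtMap hA) (sqrtOp_injective hA)

/-- The inner product `⟨A^{1/2} ξ, A^{1/2} η⟩` on `D(A^{1/2})`. -/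
instance : InnerProductSpace ℂ (FormDomain hA) :=
  InnerProductSpace.induced (FormDomain.sqrtMap hA)

/-- The space `Y = D(A^{1/2}) × X` with the inner product
`(ξ | η) = ⟨A^{1/2} ξ₁, A^{1/2} η₁⟩ + ⟨ξ₂, η₂⟩`. -/
abbrev EnergySpace (hA : IsStrictlyPositiveSA A ε) : Type _ := WithLp 2 (FormDomain hA × X)

theorem EnergySpace.inner_eq (ξ η : EnergySpace hA) :
    inner ℂ ξ η = inner ℂ (sqrtOp hA (FormDomain.toDomain hA ξ.fst))
      (sqrtOp hA (FormDomain.toDomain hA η.fst)) + inner ℂ ξ.snd η.snd := rfl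

/-- `D(H) = D(A) × D(A^{1/2})` as a subspace of `Y`. -/
def energyDomain : Submodule ℂ (EnergySpace hA) where
  carrier := {ξ | ((FormDomain.toDomain hA ξ.fst : (sqrtOp hA).domain) : X) ∈ A.domain ∧
    ξ.snd ∈ (sqrtOp hA).domain}
  add_mem' := fun hξ hη => ⟨A.domain.add_mem hξ.1 hη.1, (sqrtOp hA).domain.add_mem hξ.2 hη.2⟩
  zero_mem' := ⟨A.domain.zero_mem, (sqrtOp hA).domain.zero_mem⟩
  smul_mem' := fun c _ hξ => ⟨A.domain.smul_mem c hξ.1, (sqrtOp hA).domain.smul_mem c hξ.2⟩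

/-- The first component of an element of `D(H)`, as an element of `D(A)`. -/
def energyFst : energyDomain hA →ₗ[ℂ] A.domain where
  toFun ξ := ⟨(FormDomain.toDomain hA (ξ : EnergySpace hA).fst : (sqrtOp hA).domain), ξ.2.1⟩
  map_add' _ _ := rfl
  map_smul' _ _ := rfl

/-- The second component of an element of `D(H)`, as an element of `D(A^{1/2})`. -/
def energySnd : energyDomain hA →ₗ[ℂ] (sqrtOp hA).domain where
  toFun ξ := ⟨(ξ : EnergySpace hA).snd, ξ.2.2⟩
  map_add' _ _ := rfl
  map_smul' _ _ := rfl

/-- `H ξ = (-i ξ₂, i A ξ₁)` on `D(H) = D(A) × D(A^{1/2})`. -/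
def opH : energyDomain hA →ₗ[ℂ] EnergySpace hA where
  toFun ξ := WithLp.toLp 2
    (-Complex.I • (FormDomain.toDomain hA).symm (energySnd hA ξ), Complex.I • A (energyFst hA ξ))
  map_add' ξ η := by
    rw [← WithLp.toLp_add, Prod.mk_add_mk, map_add, map_add, map_add, smul_add,
      LinearPMap.map_add, smul_add]
  map_smul' c ξ := by
    rw [RingHom.id_apply, ← WithLp.toLp_smul, Prod.smul_mk, map_smul, map_smul, map_smul,
      LinearPMap.map_smul, smul_comm, smul_comm c Complex.I]

/-- `B̂ ξ = (0, -B ξ₂)` on `D(H)`. -/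
def opBhat (B : (sqrtOp hA).domain →ₗ[ℂ] X) : energyDomain hA →ₗ[ℂ] EnergySpace hA where
  toFun ξ := WithLp.toLp 2 (0, -B (energySnd hA ξ))
  map_add' ξ η := by
    rw [← WithLp.toLp_add, Prod.mk_add_mk, map_add, map_add, neg_add, add_zero]
  map_smul' c ξ := by
    rw [RingHom.id_apply, ← WithLp.toLp_smul, Prod.smul_mk, map_smul, map_smul, smul_neg,
      smul_zero]

/-- `V ξ = (0, i C ξ₁)` on `Y`. -/
def opV (C : (sqrtOp hA).domain →ₗ[ℂ] X) : EnergySpace hA →ₗ[ℂ] EnergySpace hA where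
  toFun ξ := WithLp.toLp 2 (0, Complex.I • C (FormDomain.toDomain hA ξ.fst))
  map_add' ξ η := by
    change WithLp.toLp 2 ((0 : FormDomain hA), Complex.I • C (FormDomain.toDomain hA
      (ξ.fst + η.fst))) = _
    rw [← WithLp.toLp_add, Prod.mk_add_mk, map_add, map_add, smul_add, add_zero]
  map_smul' c ξ := by
    change WithLp.toLp 2 ((0 : FormDomain hA), Complex.I • C (FormDomain.toDomain hA
      (c • ξ.fst))) = _
    rw [RingHom.id_apply, ← WithLp.toLp_smul, Prod.smul_mk, map_smul, map_smul, smul_zero,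
      smul_comm]

/-- `G₊ = -i (H + B̂ + V)`, with domain `D(H)`. -/
def genPlus (B C : (sqrtOp hA).domain →ₗ[ℂ] X) : EnergySpace hA →ₗ.[ℂ] EnergySpace hA where
  domain := energyDomain hA
  toFun := -Complex.I • (opH hA + opBhat hA B + opV hA C ∘ₗ (energyDomain hA).subtype)

/-- `G₋ = i (H + B̂ + V)`, with domain `D(H)`. -/
def genMinus (B C : (sqrtOp hA).domain →ₗ[ℂ] X) : EnergySpace hA →ₗ.[ℂ] EnergySpace hA where
  domain := energyDomain hA
  toFun := Complex.I • (opH hA + opBhat hA B + opV hA C ∘ₗ (energyDomain hA).subtype)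

end Energy

section SubspaceMaps

variable {p : Submodule ℂ X}

/-- Symmetry of an operator defined on a subspace `p` of `X`. -/
def IsSymmetricOn (B : p →ₗ[ℂ] X) : Prop :=
  ∀ ξ η : p, inner ℂ (B ξ) (η : X) = inner ℂ (ξ : X) (B η)

/-- Boundedness, in the norm of `X`, of an operator defined on a subspace `p` of `X`. -/
def IsBoundedOn (B : p →ₗ[ℂ] X) : Prop :=
  ∃ K : ℝ, ∀ ξ : p, ‖B ξ‖ ≤ K * ‖(ξ : X)‖

/-- The operator norm, in the norm of `X`, of a bounded operator defined on a subspace `p`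
of `X`. -/
def opNormOn (B : p →ₗ[ℂ] X) : ℝ :=
  sInf {K : ℝ | 0 ≤ K ∧ ∀ ξ : p, ‖B ξ‖ ≤ K * ‖(ξ : X)‖}

open Classical in
/-- `μ_B = 0` if `B` is symmetric, and `μ_B = ‖B‖` if `B` is bounded (and not symmetric). -/
def muB (B : p →ₗ[ℂ] X) : ℝ := if IsSymmetricOn B then 0 else opNormOn B

end SubspaceMaps

section Semigroup

variable {E : Type*} [NormedAddCommGroup E] [NormedSpace ℂ E]

/-- `T` is a strongly continuous semigroup of bounded operators on `E` with generator `G`, in the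
sign convention `T(t) = exp(-t G)`: `ξ` is in the domain of `G` and `G ξ = η` if and only if
`(ξ - T(t) ξ) / t → η` as `t → 0+`. -/
structure IsSemigroupGeneratedBy (T : ℝ≥0 → E →L[ℂ] E) (G : E →ₗ.[ℂ] E) : Prop where
  map_zero : T 0 = 1
  map_add : ∀ s t : ℝ≥0, T (s + t) = T s * T t
  continuous : ∀ ξ : E, Continuous fun t : ℝ≥0 => T t ξ
  generator : ∀ ξ η : E, (ξ, η) ∈ G.graph ↔
    Tendsto (fun t : ℝ≥0 => (((t : ℝ)⁻¹ : ℝ) : ℂ) • (ξ - T t ξ)) (𝓝[>] 0) (𝓝 η)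

end Semigroup

end AbstractWave

end

open AbstractWave

/-! Written out, `G₊` and `G₋` are `σ (-ξ₂, A₀ ξ₁ + i B ξ₂)` with `σ = 1` and `σ = -1`: the term `C
= -ε` cancels the shift in `A = A₀ + ε`. An orbit of the semigroup solves `u₁' = σ u₂`, `u₂' = -σ
(A₀ u₁ + i B u₂)`.

Generation. In the real part of `(ξ | G ξ)` the two terms with `A` cancel. What remains is at least
`-(μ_B + √ε) |ξ|²`, so `G + w` with `w = μ_B + √ε` is accretive (`IsWaveGenerator.norm_le`). Solving
`k ξ + G ξ = ζ` reduces, after elimination of `ξ₂`, to inverting `A + k² + i σ k B - ε`, a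
relatively small perturbation of `A + k²` for large `k` (`exists_add_eq`). The Hille–Yosida theorem
for contractions, proved here with Yosida approximants, applies to `G + w`, and the factor `exp (w
t)` returns to `G`.

Growth. That construction only gives the rate `exp ((μ_B + √ε) t)`. The linear bound comes from the
reduced energy `E = |u|² - ε ‖u₁‖²`, which dominates `‖u₂‖²`. Its derivative contains only the `B`
term, so `E(t) ≤ exp (2 μ_B t) E(0)`. Integrating `‖u₁'‖ = ‖u₂‖` shows that `‖u₁‖` exceeds its
initial value by at most `t exp (μ_B t) √E(0)`, and the two estimates combine to the claim. They use
the generator relation alone, hence hold for every semigroup generated by `G`; density of the domain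
extends them to `Y`. -/

noncomputable section

open scoped NNReal Topology

namespace AbstractWave

open Filter Set

/-! ### Contraction flows with bounded generators -/

section BoundedFlow

variable {E : Type*} [NormedAddCommGroup E] [NormedSpace ℂ E]

/-- The operator `exp(-t (k - Z))`. -/
def expFlow (k : ℝ) (Z : E →L[ℂ] E) (t : ℝ) : E →L[ℂ] E :=
  Real.exp (-(t * k)) • NormedSpace.exp (t • Z)

theorem expFlow_zero (k : ℝ) (Z : E →L[ℂ] E) : expFlow k Z 0 = 1 := by
  simp [expFlow, NormedSpace.exp_zero]

theorem commute_expFlow {k : ℝ} {Z W : E →L[ℂ] E} (h : Commute W Z) (t : ℝ) :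
    Commute W (expFlow k Z t) := by
  exact ((h.smul_right t).exp_right).smul_right _

variable [CompleteSpace E]

theorem expFlow_add (k : ℝ) (Z : E →L[ℂ] E) (s t : ℝ) :
    expFlow k Z (s + t) = expFlow k Z s * expFlow k Z t := by
  have h : Commute (s • Z) (t • Z) := ((Commute.refl Z).smul_left s).smul_right t
  let : NormedAlgebra ℚ (E →L[ℂ] E) := NormedAlgebra.restrictScalars ℚ ℝ (E →L[ℂ] E)
  rw [expFlow, expFlow, expFlow, add_smul, NormedSpace.exp_add_of_commute h, smul_mul_smul_comm,
    ← Real.exp_add]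
  congr 2
  ring

theorem hasDerivAt_expFlow (k : ℝ) (Z : E →L[ℂ] E) (t : ℝ) :
    HasDerivAt (expFlow k Z) (-(expFlow k Z t * (k • 1 - Z))) t := by
  have h1 : HasDerivAt (fun t : ℝ => Real.exp (-(t * k))) (Real.exp (-(t * k)) * (-k)) t := by
    have := ((hasDerivAt_id t).mul_const k).neg.exp
    simpa using this
  have h2 := h1.smul (hasDerivAt_exp_smul_const (𝕂 := ℝ) Z t)
  refine h2.congr_deriv ?_
  rw [expFlow, mul_sub, mul_smul_comm, mul_one, smul_mul_assoc]
  module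

theorem hasDerivAt_expFlow_apply (k : ℝ) (Z : E →L[ℂ] E) (t : ℝ) (x : E) :
    HasDerivAt (fun t => expFlow k Z t x) (-(expFlow k Z t ((k • (1 : E →L[ℂ] E) - Z) x))) t := by
  have h := (((ContinuousLinearMap.apply ℂ E x).restrictScalars ℝ).hasFDerivAt
    (x := expFlow k Z t)).comp_hasDerivAt t (hasDerivAt_expFlow k Z t)
  exact h

/-- Grönwall for the unshifted flow gives growth at most `exp (‖Z‖ t)`, which the scalar factor `exp
(-t k)` absorbs. -/
theorem norm_expFlow_le {k : ℝ} {Z : E →L[ℂ] E} (hZ : ‖Z‖ ≤ k) {t : ℝ} (ht : 0 ≤ t) :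
    ‖expFlow k Z t‖ ≤ 1 := by
  refine ContinuousLinearMap.opNorm_le_bound _ zero_le_one fun x => ?_
  have hd : ∀ s, HasDerivAt (fun t => expFlow 0 Z t x) (Z (expFlow 0 Z s x)) s := fun s => by
    refine (hasDerivAt_expFlow_apply 0 Z s x).congr_deriv ?_
    have h := congrArg (fun L : E →L[ℂ] E => L x)
      (commute_expFlow (k := 0) (Commute.refl Z) s).eq
    simp only [mul_apply_eq_comp] at h
    simp [h]
  have h1 := norm_le_gronwallBound_of_norm_deriv_right_le (f := fun t => expFlow 0 Z t x)
    (f' := fun s => Z (expFlow 0 Z s x)) (δ := ‖x‖) (K := ‖Z‖) (ε := 0) (a := 0) (b := t)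
    (fun s _ => (hd s).continuousAt.continuousWithinAt) (fun s _ => (hd s).hasDerivWithinAt)
    (by simp [expFlow_zero]) (fun s _ => by simpa using Z.le_opNorm _) t ⟨ht, le_rfl⟩
  rw [gronwallBound_ε0, sub_zero] at h1
  have h2 : expFlow k Z t = Real.exp (-(t * k)) • expFlow 0 Z t := by
    simp [expFlow]
  rw [h2, smul_apply, norm_smul, Real.norm_eq_abs, Real.abs_exp]
  calc Real.exp (-(t * k)) * ‖expFlow 0 Z t x‖
      ≤ Real.exp (-(t * k)) * (‖x‖ * Real.exp (k * t)) := by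
        gcongr
        exact h1.trans (by gcongr)
    _ = 1 * ‖x‖ := by
        rw [mul_left_comm, ← Real.exp_add, mul_comm t k, neg_add_cancel, Real.exp_zero]
        ring

theorem norm_expFlow_apply_le {k : ℝ} {Z : E →L[ℂ] E} (hZ : ‖Z‖ ≤ k) {t : ℝ} (ht : 0 ≤ t)
    (x : E) : ‖expFlow k Z t x‖ ≤ ‖x‖ := by
  simpa using ContinuousLinearMap.le_of_opNorm_le _ (norm_expFlow_le hZ ht) x

/-- Duhamel interpolation: `F s = exp(-sP) exp(-(t-s)Q)` joins the two flows, and commutation puts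
its derivative in the form of contractions applied to the fixed vector `(Q - P) x`. -/
theorem norm_expFlow_sub_le {k l : ℝ} {Z W : E →L[ℂ] E} (hZ : ‖Z‖ ≤ k) (hW : ‖W‖ ≤ l)
    (h : Commute Z W) {t : ℝ} (ht : 0 ≤ t) (x : E) :
    ‖expFlow k Z t x - expFlow l W t x‖ ≤
      t * ‖(k • (1 : E →L[ℂ] E) - Z) x - (l • (1 : E →L[ℂ] E) - W) x‖ := by
  set P : E →L[ℂ] E := k • (1 : E →L[ℂ] E) - Z
  set Q : E →L[ℂ] E := l • (1 : E →L[ℂ] E) - W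
  have hcomm : ∀ s, Commute P (expFlow l W s) := fun s =>
    ((Commute.one_left _).smul_left _).sub_left (commute_expFlow h s)
  let F : ℝ → E →L[ℂ] E := fun s => expFlow k Z s * expFlow l W (t - s)
  have hd : ∀ s, HasDerivAt F (expFlow k Z s * expFlow l W (t - s) * (Q - P)) s := fun s => by
    have h1 : HasDerivAt (fun s => expFlow l W (t - s)) _ s :=
      (hasDerivAt_expFlow l W (t - s)).scomp s ((hasDerivAt_id s).const_sub t)
    refine ((hasDerivAt_expFlow k Z s).mul h1).congr_deriv ?_
    change -(expFlow k Z s * P) * expFlow l W (t - s) +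
      expFlow k Z s * ((-1 : ℝ) • -(expFlow l W (t - s) * Q)) = _
    rw [neg_mul, mul_assoc, (hcomm _).eq, neg_smul, one_smul, neg_neg, mul_sub _ Q P,
      neg_add_eq_sub]
    simp only [mul_assoc]
  have hdx : ∀ s, HasDerivAt (fun s => F s x)
      ((expFlow k Z s * expFlow l W (t - s) * (Q - P)) x) s := fun s =>
    (((ContinuousLinearMap.apply ℂ E x).restrictScalars ℝ).hasFDerivAt
      (x := F s)).comp_hasDerivAt s (hd s)
  have hb := norm_image_sub_le_of_norm_deriv_le_segment' (f := fun s => F s x) (a := 0) (b := t)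
    (C := ‖P x - Q x‖) (fun s _ => (hdx s).hasDerivWithinAt) (fun s hs => by
      calc _ ≤ ‖expFlow l W (t - s) ((Q - P) x)‖ := norm_expFlow_apply_le hZ hs.1 _
        _ ≤ ‖(Q - P) x‖ := norm_expFlow_apply_le hW (sub_nonneg.mpr hs.2.le) _
        _ = _ := norm_sub_rev _ _) t ⟨ht, le_rfl⟩
  simpa [F, expFlow_zero, mul_comm] using hb

theorem norm_expFlow_sub_self_le {k : ℝ} {Z : E →L[ℂ] E} (hZ : ‖Z‖ ≤ k)
    {t : ℝ} (ht : 0 ≤ t) (x : E) :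
    ‖expFlow k Z t x - x‖ ≤ t * ‖(k • (1 : E →L[ℂ] E) - Z) x‖ := by
  have h := norm_expFlow_sub_le (l := 0) (W := 0) hZ (by simp) (Commute.zero_right Z) ht x
  simpa [expFlow, NormedSpace.exp_zero] using h

/-- First-order Taylor estimate that survives an unbounded limit. The derivative of the error
involves `P x - exp(-sP) P x`, and `P (P x)` is not controlled along the approximants. Later `y` is
the limit of `P x` and `z` a point of the domain near `y`, so that only `P z` has to stay bounded.
-/
theorem norm_expFlow_linear_approx_le {k : ℝ} {Z : E →L[ℂ] E} (hZ : ‖Z‖ ≤ k)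
    {t : ℝ} (ht : 0 ≤ t) (x y z : E) :
    ‖x - expFlow k Z t x - t • (k • (1 : E →L[ℂ] E) - Z) x‖ ≤
      t * (2 * ‖(k • (1 : E →L[ℂ] E) - Z) x - y‖ + 2 * ‖y - z‖ +
        t * ‖(k • (1 : E →L[ℂ] E) - Z) z‖) := by
  set P : E →L[ℂ] E := k • (1 : E →L[ℂ] E) - Z
  have hd : ∀ s, HasDerivAt (fun s => expFlow k Z s x + s • P x)
      (-(expFlow k Z s (P x)) + (1 : ℝ) • P x) s := fun s =>
    (hasDerivAt_expFlow_apply k Z s x).add ((hasDerivAt_id s).smul_const (P x))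
  have hb := norm_image_sub_le_of_norm_deriv_le_segment' (a := 0) (b := t)
    (C := 2 * ‖P x - y‖ + 2 * ‖y - z‖ + t * ‖P z‖) (fun s _ => (hd s).hasDerivWithinAt)
    (fun s hs => by
      have h3 := norm_expFlow_sub_self_le hZ hs.1 z
      have h4 : s * ‖P z‖ ≤ t * ‖P z‖ := mul_le_mul_of_nonneg_right hs.2.le (norm_nonneg _)
      have h5 := norm_expFlow_apply_le hZ hs.1 (P x - z)
      have h6 : ‖P x - z‖ ≤ ‖P x - y‖ + ‖y - z‖ := norm_sub_le_norm_sub_add_norm_sub _ _ _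
      have h7 : -(expFlow k Z s (P x)) + (1 : ℝ) • P x =
          (P x - z) - expFlow k Z s (P x - z) - (expFlow k Z s z - z) := by
        rw [map_sub, one_smul]
        abel
      rw [h7]
      have h8 := norm_sub_le ((P x - z) - expFlow k Z s (P x - z)) (expFlow k Z s z - z)
      have h9 := norm_sub_le (P x - z) (expFlow k Z s (P x - z))
      linarith) t ⟨ht, le_rfl⟩
  rw [← norm_neg]
  have h0 : expFlow k Z 0 x = x := by rw [expFlow_zero]; rfl
  simp only [h0, zero_smul, add_zero, sub_zero] at hb
  rw [mul_comm]
  refine (congrArg norm ?_).trans_le hb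
  abel

end BoundedFlow

/-! ### Strong convergence of contractions from a dense set -/

section DenseConvergence

variable {E : Type*} [NormedAddCommGroup E]

theorem cauchySeq_of_dist_le_mul {u v : ℕ → E} {c : ℝ} (hu : CauchySeq u) (hc : 0 ≤ c)
    (h : ∀ m n, dist (v m) (v n) ≤ c * dist (u m) (u n)) : CauchySeq v := by
  rw [Metric.cauchySeq_iff] at hu ⊢
  intro δ hδ
  obtain ⟨N, hN⟩ := hu (δ / (c + 1)) (by positivity)
  refine ⟨N, fun m hm n hn => ?_⟩
  have h1 := hN m hm n hn
  rw [lt_div_iff₀ (by positivity)] at h1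
  nlinarith [h m n, dist_nonneg (x := u m) (y := u n)]

variable [NormedSpace ℂ E]

theorem cauchySeq_apply_of_dense {L : ℕ → E →L[ℂ] E} (hL : ∀ n x, ‖L n x‖ ≤ ‖x‖) {s : Set E}
    (hs : Dense s) (h : ∀ x ∈ s, CauchySeq fun n => L n x) (x : E) :
    CauchySeq fun n => L n x := by
  rw [Metric.cauchySeq_iff]
  intro δ hδ
  obtain ⟨y, hy, hxy⟩ := Metric.mem_closure_iff.mp (hs x) (δ / 3) (by positivity)
  obtain ⟨N, hN⟩ := Metric.cauchySeq_iff.mp (h y hy) (δ / 3) (by positivity)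
  refine ⟨N, fun m hm n hn => ?_⟩
  have h1 := hN m hm n hn
  have h2 := hL m (x - y)
  have h3 := hL n (x - y)
  rw [map_sub, ← dist_eq_norm, ← dist_eq_norm] at h2 h3
  rw [dist_comm (L n x)] at h3
  have h4 := dist_triangle4 (L m x) (L m y) (L n y) (L n x)
  linarith

theorem tendsto_apply_self_of_dense {L : ℕ → E →L[ℂ] E} (hL : ∀ n x, ‖L n x‖ ≤ ‖x‖) {s : Set E}
    (hs : Dense s) (h : ∀ x ∈ s, Tendsto (fun n => L n x) atTop (𝓝 x)) (x : E) :
    Tendsto (fun n => L n x) atTop (𝓝 x) := by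
  rw [Metric.tendsto_atTop]
  intro δ hδ
  obtain ⟨y, hy, hxy⟩ := Metric.mem_closure_iff.mp (hs x) (δ / 3) (by positivity)
  obtain ⟨N, hN⟩ := Metric.tendsto_atTop.mp (h y hy) (δ / 3) (by positivity)
  refine ⟨N, fun n hn => ?_⟩
  have h1 := hN n hn
  have h2 := hL n (x - y)
  rw [map_sub, ← dist_eq_norm, ← dist_eq_norm] at h2
  have h4 := dist_triangle4 (L n x) (L n y) y x
  rw [dist_comm y x] at h4
  linarith

end DenseConvergence

/-! ### Hille–Yosida theorem -/

section HilleYosida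

variable {E : Type*} [NormedAddCommGroup E] [NormedSpace ℂ E]

/-- `R = (k + M)⁻¹` is everywhere defined and `k R` is a contraction. -/
structure IsContractiveResolvent (M : E →ₗ.[ℂ] E) (k : ℝ) (R : E →L[ℂ] E) : Prop where
  norm_le : ‖R‖ ≤ k⁻¹
  mem_graph : ∀ y, (R y, y - k • R y) ∈ M.graph
  left_inv : ∀ x y, (x, y) ∈ M.graph → R (k • x + y) = x

variable {M : E →ₗ.[ℂ] E}

/-- For `x = R (S y)` the vector `u = (l + M) x` lies in the domain and satisfies `(k + M) u = y`.
Hence `R y = u`, and applying `S` returns `x`. -/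
theorem IsContractiveResolvent.commute {k l : ℝ} {R S : E →L[ℂ] E}
    (hR : IsContractiveResolvent M k R) (hS : IsContractiveResolvent M l S) : Commute R S := by
  ext y
  change R (S y) = S (R y)
  set w := S y
  set x := R w
  have h1 : (x, w - k • x) ∈ M.graph := hR.mem_graph w
  have h2 : (w, y - l • w) ∈ M.graph := hS.mem_graph y
  have h3 := M.graph.sub_mem h2 (M.graph.smul_of_tower_mem k h1)
  have h4 := M.graph.add_mem h3 (M.graph.smul_of_tower_mem l h1)
  simp only [Prod.smul_mk, Prod.mk_sub_mk, Prod.mk_add_mk] at h4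
  have h5 := hR.left_inv _ _ h4
  have h6 := hS.left_inv _ _ h1
  have h7 : R y = w - k • x + l • x := by
    rw [← h5]
    congr 1
    module
  rw [h7, add_comm, h6]

/-- On the domain the Yosida approximant `k - k² R` equals `k R M`, and `k R` tends strongly to the
identity. -/
theorem IsContractiveResolvent.tendsto_yosida (hd : Dense (M.domain : Set E))
    {k : ℕ → ℝ} (hk : ∀ n, 0 < k n) (hk' : Tendsto k atTop atTop) {R : ℕ → E →L[ℂ] E}
    (hR : ∀ n, IsContractiveResolvent M (k n) (R n)) {x y : E} (hxy : (x, y) ∈ M.graph) :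
    Tendsto (fun n => (k n • (1 : E →L[ℂ] E) - (k n) ^ 2 • R n) x) atTop (𝓝 y) := by
  have hL : ∀ n z, ‖(k n • R n) z‖ ≤ ‖z‖ := fun n z => by
    rw [smul_apply, norm_smul, Real.norm_of_nonneg (hk n).le]
    calc k n * ‖R n z‖ ≤ k n * ((k n)⁻¹ * ‖z‖) :=
          mul_le_mul_of_nonneg_left (ContinuousLinearMap.le_of_opNorm_le _ (hR n).norm_le z)
            (hk n).le
      _ = ‖z‖ := mul_inv_cancel_left₀ (hk n).ne' _
  -- On the domain `k R z - z = -R (M z)`, which is `O(1/k)`; contractivity of `k R` gives the rest.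
  have h1 := tendsto_apply_self_of_dense hL hd (fun z hz => by
    have hg := M.mem_graph ⟨z, hz⟩
    set w := M ⟨z, hz⟩
    rw [tendsto_iff_norm_sub_tendsto_zero]
    have h2 : ∀ n, ‖(k n • R n) z - z‖ ≤ (k n)⁻¹ * ‖w‖ := fun n => by
      have h3 := (hR n).left_inv _ _ hg
      rw [map_add, ContinuousLinearMap.map_smul_of_tower] at h3
      have h4 : (k n • R n) z - z = -(R n w) := by
        change k n • R n z + R n w = z at h3
        rw [smul_apply, eq_neg_iff_add_eq_zero, sub_add_eq_add_sub, h3, sub_self]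
      rw [h4, norm_neg]
      exact ContinuousLinearMap.le_of_opNorm_le _ (hR n).norm_le w
    refine squeeze_zero (fun n => norm_nonneg _) h2 ?_
    simpa using (tendsto_inv_atTop_zero.comp hk').mul_const ‖w‖) y
  refine h1.congr fun n => ?_
  have h3 := (hR n).left_inv _ _ hxy
  rw [map_add, ContinuousLinearMap.map_smul_of_tower] at h3
  simp only [sub_apply, smul_apply,
    one_apply_eq_self]
  have h4 : k n • x = k n • (k n • R n x + R n y) := by rw [h3]
  rw [h4]
  module

/-- A contraction cannot decay backwards: `-κ` with `κ > 0` is no eigenvalue of the generator. -/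
theorem eq_zero_of_tendsto_neg_smul {T : ℝ≥0 → E →L[ℂ] E} (hT : ∀ t x, ‖T t x‖ ≤ ‖x‖) {κ : ℝ}
    (hκ : 0 < κ) {d : E} (h : Tendsto (fun t : ℝ≥0 => (((t : ℝ)⁻¹ : ℝ) : ℂ) • (d - T t d))
      (𝓝[>] 0) (𝓝 (-(κ • d)))) : d = 0 := by
  have h1 : Tendsto (fun t : ℝ≥0 => ‖(((t : ℝ)⁻¹ : ℝ) : ℂ) • (d - T t d) + κ • d‖)
      (𝓝[>] 0) (𝓝 0) := by
    simpa using (h.add_const (κ • d)).norm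
  have h2 : κ * ‖d‖ ≤ 0 := by
    refine ge_of_tendsto h1 ?_
    filter_upwards [self_mem_nhdsWithin] with t ht
    have ht' : (0 : ℝ) < t := NNReal.coe_pos.mpr ht
    have h3 : (((t : ℝ)⁻¹ : ℝ) : ℂ) • (d - T t d) + κ • d =
        ((t : ℝ)⁻¹ + κ) • d - (t : ℝ)⁻¹ • T t d := by
      rw [Complex.coe_smul]
      module
    have h4 := norm_sub_norm_le (((t : ℝ)⁻¹ + κ) • d) ((t : ℝ)⁻¹ • T t d)
    rw [h3]
    rw [norm_smul, norm_smul, Real.norm_of_nonneg (by positivity),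
      Real.norm_of_nonneg (by positivity)] at h4
    have h5 : (t : ℝ)⁻¹ * ‖T t d‖ ≤ (t : ℝ)⁻¹ * ‖d‖ :=
      mul_le_mul_of_nonneg_left (hT t d) (by positivity)
    linarith
  have h3 : ‖d‖ = 0 := by nlinarith [norm_nonneg d]
  exact norm_eq_zero.mp h3

/-- Rescaling of a semigroup by an exponential shifts its generator. -/
theorem IsSemigroupGeneratedBy.exp_smul {T : ℝ≥0 → E →L[ℂ] E} {M G : E →ₗ.[ℂ] E}
    (h : IsSemigroupGeneratedBy T M) {w : ℝ}
    (hG : ∀ x y, (x, y) ∈ G.graph ↔ (x, y + w • x) ∈ M.graph) :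
    IsSemigroupGeneratedBy (fun t => Real.exp (w * t) • T t) G where
  map_zero := by simp [h.map_zero]
  map_add s t := by
    rw [h.map_add, smul_mul_smul_comm, ← Real.exp_add, NNReal.coe_add, mul_add]
  continuous x := by
    have h1 := h.continuous x
    have h2 : Continuous fun t : ℝ≥0 => Real.exp (w * t) := by fun_prop
    exact h2.smul h1
  generator x y := by
    have hT : Tendsto (fun t : ℝ≥0 => T t x) (𝓝[>] 0) (𝓝 x) := by
      have h1 := (h.continuous x).tendsto 0
      rw [h.map_zero] at h1
      exact h1.mono_left nhdsWithin_le_nhds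
    have he : Tendsto (fun t : ℝ≥0 => (t : ℝ)⁻¹ * (Real.exp (w * t) - 1)) (𝓝[>] 0) (𝓝 w) := by
      have h1 : HasDerivAt (fun t : ℝ => Real.exp (w * t)) w 0 := by
        have := ((hasDerivAt_id (0 : ℝ)).const_mul w).exp
        simpa using this
      have h2 := h1.tendsto_slope_zero_right
      have h3 : Tendsto (fun t : ℝ≥0 => (t : ℝ)) (𝓝[>] 0) (𝓝[>] 0) := by
        refine tendsto_nhdsWithin_iff.mpr ⟨?_, ?_⟩
        · exact (NNReal.continuous_coe.tendsto 0).mono_left nhdsWithin_le_nhds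
        · filter_upwards [self_mem_nhdsWithin] with t ht
          exact NNReal.coe_pos.mpr ht
      simpa [Function.comp_def] using h2.comp h3
    have hprod := he.smul hT
    -- Product rule for difference quotients. The second summand tends to `w • x`, so either
    -- quotient converges exactly when the other does.
    have hid : ∀ t : ℝ≥0, (((t : ℝ)⁻¹ : ℝ) : ℂ) • (x - T t x) =
        (((t : ℝ)⁻¹ : ℝ) : ℂ) • (x - (Real.exp (w * t) • T t) x) +
          ((t : ℝ)⁻¹ * (Real.exp (w * t) - 1)) • T t x := fun t => by
      rw [Complex.coe_smul, Complex.coe_smul, smul_apply]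
      module
    rw [hG, h.generator]
    constructor
    · intro h1
      have h2 := h1.sub hprod
      rw [add_sub_cancel_right] at h2
      refine h2.congr fun t => ?_
      rw [hid t, add_sub_cancel_right]
    · intro h1
      refine (h1.add hprod).congr fun t => (hid t).symm

variable [CompleteSpace E]

/-- The flows of the approximants form Cauchy sequences on the domain by the Duhamel estimate, hence
everywhere. Only one inclusion is obtained: the generator of the limit extends `M`. -/
theorem exists_semigroup_of_tendsto (hd : Dense (M.domain : Set E))
    {k : ℕ → ℝ} {Z : ℕ → E →L[ℂ] E} (hZ : ∀ n, ‖Z n‖ ≤ k n) (hcomm : ∀ m n, Commute (Z m) (Z n))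
    (hlim : ∀ x y, (x, y) ∈ M.graph →
      Tendsto (fun n => (k n • (1 : E →L[ℂ] E) - Z n) x) atTop (𝓝 y)) :
    ∃ T : ℝ≥0 → E →L[ℂ] E, T 0 = 1 ∧ (∀ s t, T (s + t) = T s * T t) ∧
      (∀ x, Continuous fun t => T t x) ∧ (∀ t x, ‖T t x‖ ≤ ‖x‖) ∧
      ∀ x y, (x, y) ∈ M.graph → Tendsto (fun t : ℝ≥0 => (((t : ℝ)⁻¹ : ℝ) : ℂ) • (x - T t x))
        (𝓝[>] 0) (𝓝 y) := by
  let U : ℕ → ℝ≥0 → E →L[ℂ] E := fun n t => expFlow (k n) (Z n) t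
  have hU : ∀ t n x, ‖U n t x‖ ≤ ‖x‖ := fun t n x => norm_expFlow_apply_le (hZ n) t.2 x
  have hcau : ∀ t x, CauchySeq fun n => U n t x := fun t =>
    cauchySeq_apply_of_dense (hU t) hd fun x hx => by
      refine cauchySeq_of_dist_le_mul (c := t) (hlim _ _ (M.mem_graph ⟨x, hx⟩)).cauchySeq t.2
        fun m n => ?_
      rw [dist_eq_norm, dist_eq_norm]
      exact norm_expFlow_sub_le (hZ m) (hZ n) (hcomm m n) t.2 x
  choose f hf using fun t x => cauchySeq_tendsto_of_complete (hcau t x)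
  let T : ℝ≥0 → E →L[ℂ] E := fun t =>
    continuousLinearMapOfTendsto (fun n => U n t) (tendsto_pi_nhds.mpr (hf t))
  have hT : ∀ t x, Tendsto (fun n => U n t x) atTop (𝓝 (T t x)) := hf
  have hTc : ∀ t x, ‖T t x‖ ≤ ‖x‖ := fun t x =>
    le_of_tendsto (hT t x).norm (Eventually.of_forall fun n => hU t n x)
  have h0 : T 0 = 1 := by
    ext x
    refine tendsto_nhds_unique (hT 0 x) ?_
    simp [U, expFlow_zero]
  have hadd : ∀ s t, T (s + t) = T s * T t := by
    intro s t
    ext x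
    refine tendsto_nhds_unique (hT (s + t) x) ?_
    -- Both factors depend on `n`; contractivity of `U n s` makes the error from replacing the inner
    -- one by its limit vanish.
    have h1 : ∀ n, U n (s + t) x = U n s (T t x) + U n s (U n t x - T t x) := fun n => by
      rw [← map_add, add_sub_cancel]
      simp only [U, NNReal.coe_add, expFlow_add]
      rfl
    simp only [h1]
    have h2 := (hT s (T t x)).add (squeeze_zero_norm (fun n => hU s n (U n t x - T t x))
      (tendsto_iff_norm_sub_tendsto_zero.mp (hT t x)))
    rwa [add_zero] at h2
  have hlip : ∀ x y, (x, y) ∈ M.graph → ∀ t, ‖T t x - x‖ ≤ t * ‖y‖ := fun x y hxy t =>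
    le_of_tendsto_of_tendsto ((hT t x).sub_const x).norm ((hlim x y hxy).norm.const_mul (t : ℝ))
      (Eventually.of_forall fun n => norm_expFlow_sub_self_le (hZ n) t.2 x)
  have hlip' : ∀ x y, (x, y) ∈ M.graph → ∀ s t, s ≤ t → ‖T t x - T s x‖ ≤ (t - s) * ‖y‖ := by
    intro x y hxy s t hst
    have h1 : T t x = T s (T (t - s) x) := by
      conv_lhs => rw [← add_tsub_cancel_of_le hst, hadd]
      rfl
    rw [h1, ← map_sub, ← NNReal.coe_sub hst]
    exact (hTc _ _).trans (hlip x y hxy _)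
  refine ⟨T, h0, hadd, fun x => ?_, hTc, fun x y hxy => ?_⟩
  · refine continuous_of_uniform_approx_of_continuous fun u hu => ?_
    obtain ⟨δ, hδ, hδu⟩ := Metric.mem_uniformity_dist.mp hu
    obtain ⟨z, hz, hxz⟩ := Metric.mem_closure_iff.mp (hd x) δ hδ
    refine ⟨fun t => T t z, ?_, fun t => hδu ?_⟩
    · have hl : LipschitzWith (Real.toNNReal ‖M ⟨z, hz⟩‖) fun t => T t z := by
        refine LipschitzWith.of_dist_le_mul fun s t => ?_
        rw [Real.coe_toNNReal _ (norm_nonneg _), mul_comm]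
        have key := hlip' z _ (M.mem_graph ⟨z, hz⟩)
        rcases le_total s t with hst | hst
        · rw [dist_comm, dist_comm s t, dist_eq_norm, NNReal.dist_eq,
            abs_of_nonneg (sub_nonneg.mpr (NNReal.coe_le_coe.mpr hst))]
          exact key s t hst
        · rw [dist_eq_norm, NNReal.dist_eq,
            abs_of_nonneg (sub_nonneg.mpr (NNReal.coe_le_coe.mpr hst))]
          exact key t s hst
      exact hl.continuous
    · rw [dist_eq_norm, ← map_sub]
      rw [dist_eq_norm] at hxz
      exact (hTc _ _).trans_lt hxz
  · have key : ∀ z w, (z, w) ∈ M.graph → ∀ t : ℝ≥0,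
        ‖x - T t x - (t : ℝ) • y‖ ≤ t * (2 * ‖y - z‖ + t * ‖w‖) := by
      intro z w hzw t
      have h1 : Tendsto (fun n => ‖x - U n t x - (t : ℝ) • (k n • (1 : E →L[ℂ] E) - Z n) x‖) atTop
          (𝓝 ‖x - T t x - (t : ℝ) • y‖) :=
        (((hT t x).const_sub x).sub ((hlim x y hxy).const_smul (t : ℝ))).norm
      have h2 : Tendsto (fun n => (t : ℝ) * (2 * ‖(k n • (1 : E →L[ℂ] E) - Z n) x - y‖ +
          2 * ‖y - z‖ + t * ‖(k n • (1 : E →L[ℂ] E) - Z n) z‖)) atTop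
          (𝓝 (t * (2 * 0 + 2 * ‖y - z‖ + t * ‖w‖))) :=
        ((((tendsto_iff_norm_sub_tendsto_zero.mp (hlim x y hxy)).const_mul 2).add_const _).add
          ((hlim z w hzw).norm.const_mul (t : ℝ))).const_mul (t : ℝ)
      simp only [mul_zero, zero_add] at h2
      exact le_of_tendsto_of_tendsto h1 h2
        (Eventually.of_forall fun n => norm_expFlow_linear_approx_le (hZ n) t.2 x y z)
    rw [Metric.tendsto_nhds]
    intro δ hδ
    obtain ⟨z, hz, hyz⟩ := Metric.mem_closure_iff.mp (hd y) (δ / 4) (by positivity)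
    have hkey := key z _ (M.mem_graph ⟨z, hz⟩)
    set w := M ⟨z, hz⟩
    have hlt : ∀ᶠ t : ℝ≥0 in 𝓝[>] 0, (t : ℝ) * ‖w‖ < δ / 2 := by
      have hc : Continuous fun t : ℝ≥0 => (t : ℝ) * ‖w‖ := by fun_prop
      have := hc.tendsto 0
      simp only [NNReal.coe_zero, zero_mul] at this
      exact (this.mono_left nhdsWithin_le_nhds).eventually_lt_const (by positivity)
    filter_upwards [hlt, self_mem_nhdsWithin] with t ht htpos
    have htpos' : (0 : ℝ) < t := NNReal.coe_pos.mpr htpos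
    have h3 : (((t : ℝ)⁻¹ : ℝ) : ℂ) • (x - T t x) - y =
        (t : ℝ)⁻¹ • (x - T t x - (t : ℝ) • y) := by
      rw [smul_sub _ (x - T t x), inv_smul_smul₀ htpos'.ne', Complex.coe_smul]
    rw [dist_eq_norm, h3, norm_smul, Real.norm_of_nonneg (by positivity)]
    rw [dist_eq_norm] at hyz
    calc _ ≤ (t : ℝ)⁻¹ * (t * (2 * ‖y - z‖ + t * ‖w‖)) := by
          gcongr
          exact hkey t
      _ = 2 * ‖y - z‖ + t * ‖w‖ := inv_mul_cancel_left₀ htpos'.ne' _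
      _ < δ := by linarith

/-- The Hille–Yosida theorem for contraction semigroups. -/
theorem exists_isSemigroupGeneratedBy_of_contractiveResolvent (hd : Dense (M.domain : Set E))
    {κ : ℝ} (hκ : 0 < κ)
    (hR : ∀ k, κ ≤ k → ∃ R, IsContractiveResolvent M k R) :
    ∃ T, IsSemigroupGeneratedBy T M := by
  have hle : ∀ n : ℕ, κ ≤ κ + n := fun n => le_add_of_nonneg_right n.cast_nonneg
  have hpos : ∀ n : ℕ, 0 < κ + n := fun n => hκ.trans_le (hle n)
  choose R hRn using fun n : ℕ => hR (κ + n) (hle n)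
  have hk' : Tendsto (fun n : ℕ => κ + n) atTop atTop :=
    tendsto_atTop_add_const_left _ _ tendsto_natCast_atTop_atTop
  -- With `Z = k² R`, the difference `k - Z` is the Yosida approximant and `‖R‖ ≤ k⁻¹` gives `‖Z‖ ≤
  -- k`.
  obtain ⟨T, h0, hadd, hcont, hT, hgen⟩ := exists_semigroup_of_tendsto (M := M) hd
    (k := fun n : ℕ => κ + n) (Z := fun n => (κ + n : ℝ) ^ 2 • R n)
    (fun n => by
      rw [norm_smul, Real.norm_of_nonneg (by positivity)]
      calc (κ + n) ^ 2 * ‖R n‖ ≤ (κ + n) ^ 2 * (κ + n)⁻¹ :=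
            mul_le_mul_of_nonneg_left (hRn n).norm_le (by positivity)
        _ = κ + n := by
            have := (hpos n).ne'
            field_simp)
    (fun m n => (((hRn m).commute (hRn n)).smul_left _).smul_right _)
    (fun x y hxy => IsContractiveResolvent.tendsto_yosida hd hpos hk' hRn hxy)
  refine ⟨T, h0, hadd, hcont, fun x y => ⟨hgen x y, fun hxy => ?_⟩⟩
  -- Converse inclusion: index `0` has parameter `κ`, so `z` solves `(κ + M) z = κ x + y`. Then `x -
  -- z` is an eigenvector of the generator for `-κ` unless it vanishes, as it must for a
  -- contraction.
  have hg := (hRn 0).mem_graph (κ • x + y)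
  simp only [Nat.cast_zero, add_zero] at hg
  set z := R 0 (κ • x + y)
  have h1 := hxy.sub (hgen _ _ hg)
  have h2 : x - z = 0 := by
    refine eq_zero_of_tendsto_neg_smul hT hκ ?_
    have h3 : -(κ • (x - z)) = y - (κ • x + y - κ • z) := by module
    rw [h3]
    refine h1.congr fun t => ?_
    rw [← smul_sub, map_sub]
    congr 1
    abel
  rw [sub_eq_zero] at h2
  rw [← h2] at hg
  simpa using hg

end HilleYosida

/-! ### Resolvents from accretivity and the range condition -/

section Resolvent

variable {E : Type*} [NormedAddCommGroup E] [NormedSpace ℂ E] {M : E →ₗ.[ℂ] E}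

theorem exists_isContractiveResolvent {k : ℝ} (hk : 0 < k)
    (hle : ∀ x y, (x, y) ∈ M.graph → k * ‖x‖ ≤ ‖k • x + y‖)
    (hsurj : ∀ z, ∃ x y, (x, y) ∈ M.graph ∧ k • x + y = z) :
    ∃ R, IsContractiveResolvent M k R := by
  have huniq : ∀ x y x' y', (x, y) ∈ M.graph → (x', y') ∈ M.graph →
      k • x + y = k • x' + y' → x = x' := by
    intro x y x' y' h h' heq
    have h1 := hle _ _ (M.graph.sub_mem h h')
    have h2 : k • (x - x') + (y - y') = 0 := by
      rw [smul_sub, sub_add_sub_comm, heq, sub_self]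
    rw [h2, norm_zero] at h1
    rw [← sub_eq_zero, ← norm_eq_zero]
    nlinarith [norm_nonneg (x - x')]
  choose f g hfg heq using hsurj
  let L : E →ₗ[ℂ] E :=
    { toFun := f
      map_add' := fun y z => huniq _ _ _ _ (hfg _) (M.graph.add_mem (hfg y) (hfg z)) (by
        rw [heq, smul_add, add_add_add_comm, heq, heq])
      map_smul' := fun c z => huniq _ _ _ _ (hfg _) (M.graph.smul_mem c (hfg z)) (by
        rw [heq, RingHom.id_apply, smul_comm k c, ← smul_add, heq]) }
  have hL : ∀ z, ‖L z‖ ≤ k⁻¹ * ‖z‖ := fun z => by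
    have h1 := hle _ _ (hfg z)
    rw [heq] at h1
    rw [inv_mul_eq_div, le_div_iff₀ hk, mul_comm]
    exact h1
  refine ⟨L.mkContinuous k⁻¹ hL, L.mkContinuous_norm_le (by positivity) hL, fun z => ?_,
    fun x y hxy => huniq _ _ _ _ (hfg _) hxy (heq _)⟩
  change (f z, z - k • f z) ∈ M.graph
  have h1 : z - k • f z = g z := by rw [sub_eq_iff_eq_add', heq]
  rw [h1]
  exact hfg z

end Resolvent

/-! ### Shifts by a constant -/

section AddConst

variable {X : Type*} [NormedAddCommGroup X] [InnerProductSpace ℂ X]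

theorem addConst_apply (A : X →ₗ.[ℂ] X) (c : ℝ) (x : A.domain) :
    addConst A c x = A x + (c : ℂ) • (x : X) := rfl

theorem mem_graph_addConst_iff (A : X →ₗ.[ℂ] X) (c : ℝ) (x y : X) :
    (x, y) ∈ A.graph ↔ (x, y + c • x) ∈ (addConst A c).graph := by
  rw [LinearPMap.mem_graph_iff, LinearPMap.mem_graph_iff]
  change (∃ z : A.domain, (z : X) = x ∧ A z = y) ↔
    ∃ z : A.domain, (z : X) = x ∧ A z + (c : ℂ) • (z : X) = y + c • x
  refine exists_congr fun z => and_congr_right fun hz => ?_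
  rw [hz, Complex.coe_smul, add_left_inj]

variable [CompleteSpace X]

theorem isSelfAdjoint_addConst {A : X →ₗ.[ℂ] X} (hA : IsSelfAdjoint A) (c : ℝ) :
    IsSelfAdjoint (addConst A c) := by
  have hd : Dense ((addConst A c).domain : Set X) := hA.dense_domain
  have hf := LinearPMap.adjoint_isFormalAdjoint hA.dense_domain
  rw [LinearPMap.isSelfAdjoint_def.mp hA] at hf
  rw [LinearPMap.isSelfAdjoint_def]
  refine le_antisymm (LinearPMap.le_of_le_graph ?_)
    (LinearPMap.IsFormalAdjoint.le_adjoint hd fun (x : A.domain) (y : A.domain) => ?_)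
  · rintro ⟨v, w⟩ hvw
    obtain ⟨z, h1, h2⟩ := LinearPMap.mem_graph_iff _ |>.mp hvw
    simp only at h1 h2
    have h3 : (v, w - c • v) ∈ A.graph := mem_graph_of_isSelfAdjoint hA fun x => by
      have h4 := LinearPMap.adjoint_isFormalAdjoint hd z x
      rw [h1, h2, addConst_apply, inner_add_right] at h4
      rw [inner_sub_left, h4, inner_smul_right, ← Complex.coe_smul, inner_smul_left,
        Complex.conj_ofReal, add_sub_cancel_right]
    have h4 := (mem_graph_addConst_iff A c _ _).mp h3
    rwa [sub_add_cancel] at h4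
  · rw [addConst_apply, addConst_apply, inner_add_left, inner_add_right, hf x y, inner_smul_left,
      inner_smul_right, Complex.conj_ofReal]

/-- Used with `c = k²`, to make `A + k²` bijective. -/
theorem IsStrictlyPositiveSA.addConst {A : X →ₗ.[ℂ] X} {ε c : ℝ} (hA : IsStrictlyPositiveSA A ε)
    (hc : 0 ≤ c) : IsStrictlyPositiveSA (addConst A c) (ε + c) where
  isSelfAdjoint := isSelfAdjoint_addConst hA.isSelfAdjoint c
  eps_pos := add_pos_of_pos_of_nonneg hA.eps_pos hc
  lower_bound := fun (x : A.domain) => by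
    rw [addConst_apply, inner_add_right, inner_smul_right, inner_self_eq_norm_sq_to_K]
    have := hA.lower_bound x
    rw [Complex.add_re]
    have h2 : ((c : ℂ) * ((‖(x : X)‖ : ℂ)) ^ 2).re = c * ‖(x : X)‖ ^ 2 := by
      rw [← Complex.ofReal_pow, ← Complex.ofReal_mul, Complex.ofReal_re]
    change _ ≤ _ + ((c : ℂ) * ((‖(x : X)‖ : ℂ)) ^ 2).re
    rw [h2]
    linarith

end AddConst

/-! ### The square root of `A` -/

section Sqrt

variable {X : Type*} [NormedAddCommGroup X] [InnerProductSpace ℂ X] [CompleteSpace X]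
  {A : X →ₗ.[ℂ] X} {ε : ℝ} (hA : IsStrictlyPositiveSA A ε)

theorem sqrtOp_formal (x y : (sqrtOp hA).domain) :
    inner ℂ (sqrtOp hA x) (y : X) = inner ℂ (x : X) (sqrtOp hA y) := by
  have hS := (sqrtOp_spec hA).isSelfAdjoint
  have h := LinearPMap.adjoint_isFormalAdjoint hS.dense_domain
  rw [LinearPMap.isSelfAdjoint_def.mp hS] at h
  exact h x y

/-- The inclusion `D(A) → D(A^{1/2})`. -/
def inclDomain : A.domain →ₗ[ℂ] (sqrtOp hA).domain :=
  Submodule.inclusion (domain_le_sqrtOp_domain hA)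

theorem inner_sqrtOp_sqrtOp (x : A.domain) (y : (sqrtOp hA).domain) :
    inner ℂ (sqrtOp hA (inclDomain hA x)) (sqrtOp hA y) = inner ℂ (A x) (y : X) := by
  obtain ⟨z, h1, h2⟩ := ((sqrtOp_spec hA).sq_eq x (A x)).mp (A.mem_graph x)
  obtain ⟨u, hu, hu'⟩ := (LinearPMap.mem_graph_iff _).mp h1
  obtain ⟨v, hv, hv'⟩ := (LinearPMap.mem_graph_iff _).mp h2
  simp only at hu hu' hv hv'
  have h3 : inclDomain hA x = u := Subtype.ext hu.symm
  rw [h3, hu', ← hv, ← sqrtOp_formal, hv']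

theorem sqrtOp_surjective (y : X) : ∃ x, sqrtOp hA x = y := by
  obtain ⟨x, hx⟩ := hA.surjective y
  have h : ((x : X), y) ∈ A.graph := (LinearPMap.mem_graph_iff _).mpr ⟨x, rfl, hx⟩
  obtain ⟨z, -, h2⟩ := ((sqrtOp_spec hA).sq_eq x y).mp h
  obtain ⟨v, -, hv'⟩ := (LinearPMap.mem_graph_iff _).mp h2
  exact ⟨v, hv'⟩

/-- Take `w` with `A w = A^{1/2} x`. Then `x = A^{1/2} w`, so `‖x‖² = ⟨w, A^{1/2} x⟩`, and `ε ‖w‖ ≤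
‖A w‖ = ‖A^{1/2} x‖`. -/
theorem sqrtOp_lower_bound (x : (sqrtOp hA).domain) :
    ε * ‖(x : X)‖ ^ 2 ≤ ‖sqrtOp hA x‖ ^ 2 := by
  have hε := hA.eps_pos
  obtain ⟨w, hw⟩ := hA.surjective (sqrtOp hA x)
  change A w = _ at hw
  obtain ⟨z, h1, h2⟩ := ((sqrtOp_spec hA).sq_eq w (A w)).mp (A.mem_graph w)
  obtain ⟨u, hu, hu'⟩ := (LinearPMap.mem_graph_iff _).mp h1
  obtain ⟨v, hv, hv'⟩ := (LinearPMap.mem_graph_iff _).mp h2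
  simp only at hu hu' hv hv'
  have hvx : v = x := sqrtOp_injective hA (hv'.trans hw)
  have h3 : inner ℂ (x : X) (x : X) = inner ℂ (w : X) (sqrtOp hA x) := by
    have h4 : sqrtOp hA u = x := by rw [hu', ← hv, hvx]
    rw [← hu, ← sqrtOp_formal, h4]
  have h4 : ‖(x : X)‖ ^ 2 ≤ ‖(w : X)‖ * ‖sqrtOp hA x‖ := by
    rw [← inner_self_eq_norm_sq (𝕜 := ℂ), h3]
    exact (Complex.re_le_norm _).trans (norm_inner_le_norm _ _)
  have h5 := hA.norm_le w
  rw [hw] at h5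
  nlinarith [norm_nonneg (sqrtOp hA x)]

end Sqrt

/-! ### The energy space -/

section FormDomain

variable {X : Type*} [NormedAddCommGroup X] [InnerProductSpace ℂ X] [CompleteSpace X]
  {A : X →ₗ.[ℂ] X} {ε : ℝ} (hA : IsStrictlyPositiveSA A ε)

/-- By the choice of norm, `A^{1/2}` is an isometric bijection onto `X`. -/
instance : CompleteSpace (FormDomain hA) := by
  let i : FormDomain hA →ₗᵢ[ℂ] X := ⟨FormDomain.sqrtMap hA, fun _ => rfl⟩
  have hi : Function.Surjective i := fun y => by
    obtain ⟨x, hx⟩ := sqrtOp_surjective hA y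
    exact ⟨(FormDomain.toDomain hA).symm x, hx⟩
  exact (i.isometry.isUniformInducing.completeSpace_congr hi).mpr inferInstance

/-- The embedding of the energy space `D(A^{1/2})` into `X`. -/
def FormDomain.incl : FormDomain hA →L[ℂ] X :=
  ((sqrtOp hA).domain.subtype ∘ₗ (FormDomain.toDomain hA).toLinearMap).mkContinuous (√ε)⁻¹
    fun u => by
      have hε := Real.sqrt_pos.mpr hA.eps_pos
      rw [inv_mul_eq_div, le_div_iff₀ hε]
      refine le_of_sq_le_sq ?_ (norm_nonneg u)
      rw [mul_pow, Real.sq_sqrt hA.eps_pos.le, mul_comm]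
      exact sqrtOp_lower_bound hA (FormDomain.toDomain hA u)

theorem FormDomain.incl_apply (u : FormDomain hA) :
    FormDomain.incl hA u = (FormDomain.toDomain hA u : X) := rfl

theorem FormDomain.norm_incl_sq_le (u : FormDomain hA) :
    ε * ‖FormDomain.incl hA u‖ ^ 2 ≤ ‖u‖ ^ 2 :=
  sqrtOp_lower_bound hA (FormDomain.toDomain hA u)

theorem dense_energyDomain : Dense (energyDomain hA : Set (EnergySpace hA)) := by
  rw [Submodule.dense_iff_topologicalClosure_eq_top,
    Submodule.topologicalClosure_eq_top_iff, Submodule.eq_bot_iff]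
  intro v hv
  rw [Submodule.mem_orthogonal] at hv
  have h1 : v.fst = 0 := by
    -- The energy product of `x ∈ D(A)` with `v₁` is `⟨A x, v₁⟩`; choosing `A x = v₁` turns
    -- orthogonality into `‖v₁‖² = 0`.
    obtain ⟨x, hx⟩ := hA.surjective (FormDomain.incl hA v.fst)
    have hmem : (WithLp.toLp 2 ((FormDomain.toDomain hA).symm (inclDomain hA x), (0 : X)) :
        EnergySpace hA) ∈ energyDomain hA := ⟨x.2, (sqrtOp hA).domain.zero_mem⟩
    have h2 := hv _ hmem
    rw [EnergySpace.inner_eq] at h2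
    change inner ℂ (sqrtOp hA (inclDomain hA x)) (sqrtOp hA (FormDomain.toDomain hA v.fst)) +
      inner ℂ (0 : X) v.snd = 0 at h2
    rw [inner_zero_left, add_zero, inner_sqrtOp_sqrtOp] at h2
    change A x = _ at hx
    rw [hx, ← FormDomain.incl_apply, inner_self_eq_zero] at h2
    exact (FormDomain.toDomain hA).injective (Subtype.ext h2)
  have h2 : v.snd = 0 := by
    have hd : Dense ((sqrtOp hA).domain : Set X) := (sqrtOp_spec hA).isSelfAdjoint.dense_domain
    refine hd.eq_zero_of_inner_left (𝕜 := ℂ) fun x hx => ?_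
    have hmem : (WithLp.toLp 2 ((0 : FormDomain hA), x) :
        EnergySpace hA) ∈ energyDomain hA := ⟨A.domain.zero_mem, hx⟩
    have h2 := hv _ hmem
    rw [WithLp.prod_inner_apply] at h2
    change inner ℂ (0 : FormDomain hA) v.fst + inner ℂ x v.snd = 0 at h2
    rw [inner_zero_left, zero_add] at h2
    rw [← inner_conj_symm, h2, map_zero]
  exact WithLp.ofLp_injective 2 (Prod.ext h1 h2)

end FormDomain

/-! ### The constant `μ_B` -/

section MuB

variable {X : Type*} [NormedAddCommGroup X] [InnerProductSpace ℂ X] {p : Submodule ℂ X}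

theorem opNormOn_nonneg (B : p →ₗ[ℂ] X) : 0 ≤ opNormOn B :=
  Real.sInf_nonneg fun _ h => h.1

theorem IsBoundedOn.norm_le {B : p →ₗ[ℂ] X} (hB : IsBoundedOn B) (x : p) :
    ‖B x‖ ≤ opNormOn B * ‖(x : X)‖ := by
  obtain ⟨K, hK⟩ := hB
  have hne : {K : ℝ | 0 ≤ K ∧ ∀ ξ : p, ‖B ξ‖ ≤ K * ‖(ξ : X)‖}.Nonempty :=
    ⟨|K|, abs_nonneg K, fun ξ => (hK ξ).trans
      (mul_le_mul_of_nonneg_right (le_abs_self K) (norm_nonneg _))⟩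
  rcases (norm_nonneg (x : X)).eq_or_lt with h | h
  · have := hK x
    rwa [← h, mul_zero] at this ⊢
  · rw [← div_le_iff₀ h]
    exact le_csInf hne fun L hL => (div_le_iff₀ h).mpr (hL.2 x)

theorem muB_nonneg (B : p →ₗ[ℂ] X) : 0 ≤ muB B := by
  unfold muB
  split_ifs
  · exact le_rfl
  · exact opNormOn_nonneg B

/-- In the symmetric case `⟨x, B x⟩` is real, so the left side vanishes; otherwise Cauchy–Schwarz
applies. -/
theorem abs_re_inner_le_muB {B : p →ₗ[ℂ] X} (hB : IsSymmetricOn B ∨ IsBoundedOn B) (x : p) :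
    |(inner ℂ (x : X) (Complex.I • B x)).re| ≤ muB B * ‖(x : X)‖ ^ 2 := by
  unfold muB
  split_ifs with h
  · have h1 := h x x
    rw [← inner_conj_symm, Complex.conj_eq_iff_im] at h1
    rw [inner_smul_right, Complex.I_mul_re, h1]
    simp
  · have h1 := (hB.resolve_left h).norm_le x
    calc _ ≤ ‖inner ℂ (x : X) (Complex.I • B x)‖ := Complex.abs_re_le_norm _
      _ ≤ ‖(x : X)‖ * ‖Complex.I • B x‖ := norm_inner_le_norm _ _
      _ ≤ ‖(x : X)‖ * (opNormOn B * ‖(x : X)‖) := by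
        rw [norm_smul, Complex.norm_I, one_mul]
        gcongr
      _ = _ := by ring

end MuB

/-! ### The wave operators: accretivity and range -/

section WaveGenerator

variable {X : Type*} [NormedAddCommGroup X] [InnerProductSpace ℂ X] [CompleteSpace X]
  {A : X →ₗ.[ℂ] X} {ε : ℝ} (hA : IsStrictlyPositiveSA A ε)

/-- `G ξ = σ (-ξ₂, A ξ₁ + i B ξ₂ - ε ξ₁)` on `D(H)`. -/
def IsWaveGenerator (B : (sqrtOp hA).domain →ₗ[ℂ] X) (σ : ℝ)
    (G : EnergySpace hA →ₗ.[ℂ] EnergySpace hA) : Prop :=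
  ∀ ξ η : EnergySpace hA, (ξ, η) ∈ G.graph ↔ ∃ (x : A.domain) (z : (sqrtOp hA).domain),
    FormDomain.toDomain hA ξ.fst = inclDomain hA x ∧ ξ.snd = z ∧
    FormDomain.toDomain hA η.fst = -(σ • z) ∧
    η.snd = σ • (A x + Complex.I • B z - ε • (x : X))

section Generators

variable {B C : (sqrtOp hA).domain →ₗ[ℂ] X}

theorem isWaveGenerator_of_apply {σ : ℝ} {G : EnergySpace hA →ₗ.[ℂ] EnergySpace hA}
    (hdom : G.domain = energyDomain hA)
    (hG : ∀ (ξ : energyDomain hA) (η : EnergySpace hA), ((ξ : EnergySpace hA), η) ∈ G.graph ↔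
      FormDomain.toDomain hA η.fst = -(σ • energySnd hA ξ) ∧
      η.snd = σ • (A (energyFst hA ξ) + Complex.I • B (energySnd hA ξ) -
        ε • (energyFst hA ξ : X))) :
    IsWaveGenerator hA B σ G := by
  intro ξ η
  constructor
  · intro h
    have hξ : ξ ∈ energyDomain hA := by
      rw [← hdom]
      exact LinearPMap.mem_domain_iff.mpr ⟨η, h⟩
    obtain ⟨h1, h2⟩ := (hG ⟨ξ, hξ⟩ η).mp h
    exact ⟨energyFst hA ⟨ξ, hξ⟩, energySnd hA ⟨ξ, hξ⟩, rfl, rfl, h1, h2⟩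
  · rintro ⟨x, z, h1, h2, h3, h4⟩
    have hξ : ξ ∈ energyDomain hA := by
      refine ⟨?_, ?_⟩
      · rw [h1]
        exact x.2
      · rw [h2]
        exact z.2
    have hx' : (FormDomain.toDomain hA ξ.fst : X) = x := congrArg Subtype.val h1
    have hx : energyFst hA ⟨ξ, hξ⟩ = x := Subtype.ext hx'
    have hz : energySnd hA ⟨ξ, hξ⟩ = z := Subtype.ext h2
    refine (hG ⟨ξ, hξ⟩ η).mpr ?_
    rw [hx, hz]
    exact ⟨h3, h4⟩

theorem isWaveGenerator_genPlus
    (hC : ∀ ξ : (sqrtOp hA).domain, C ξ = -((ε : ℂ) • (ξ : X))) :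
    IsWaveGenerator hA B 1 (genPlus hA B C) := by
  refine isWaveGenerator_of_apply hA rfl fun ξ η => ?_
  have hmem : ((ξ : EnergySpace hA), η) ∈ (genPlus hA B C).graph ↔ genPlus hA B C ξ = η :=
    ⟨fun h => by
      obtain ⟨z, h1, h2⟩ := (LinearPMap.mem_graph_iff _).mp h
      have h3 : z = ξ := Subtype.ext h1
      subst h3
      exact h2, fun h => (LinearPMap.mem_graph_iff _).mpr ⟨ξ, rfl, h⟩⟩
  rw [hmem]
  have h1 : FormDomain.toDomain hA (genPlus hA B C ξ).fst = -((1 : ℝ) • energySnd hA ξ) := by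
    change -Complex.I • (-Complex.I • energySnd hA ξ + 0 + 0) = _
    rw [add_zero, add_zero, smul_smul, neg_mul_neg, Complex.I_mul_I, one_smul, neg_one_smul]
  have h2 : (genPlus hA B C ξ).snd = (1 : ℝ) • (A (energyFst hA ξ) +
      Complex.I • B (energySnd hA ξ) - ε • (energyFst hA ξ : X)) := by
    change -Complex.I • (Complex.I • A (energyFst hA ξ) + -B (energySnd hA ξ) +
      Complex.I • C (FormDomain.toDomain hA (ξ : EnergySpace hA).fst)) = _
    rw [hC, Complex.coe_smul]
    change -Complex.I • (Complex.I • A (energyFst hA ξ) + -B (energySnd hA ξ) +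
      Complex.I • -(ε • (energyFst hA ξ : X))) = _
    rw [smul_add, smul_add, smul_smul, smul_smul, neg_mul, Complex.I_mul_I, neg_neg, one_smul,
      one_smul, one_smul, neg_smul, smul_neg, neg_neg, sub_eq_add_neg]
  rw [← h1, ← h2]
  constructor
  · rintro rfl
    exact ⟨rfl, rfl⟩
  · rintro ⟨h3, h4⟩
    exact WithLp.ofLp_injective 2 (Prod.ext ((FormDomain.toDomain hA).injective h3.symm) h4.symm)

theorem isWaveGenerator_genMinus
    (hC : ∀ ξ : (sqrtOp hA).domain, C ξ = -((ε : ℂ) • (ξ : X))) :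
    IsWaveGenerator hA B (-1) (genMinus hA B C) := by
  have hneg : ∀ ξ η, (ξ, η) ∈ (genMinus hA B C).graph ↔ (ξ, -η) ∈ (genPlus hA B C).graph := by
    intro ξ η
    rw [LinearPMap.mem_graph_iff, LinearPMap.mem_graph_iff]
    refine exists_congr fun x => and_congr_right fun _ => ?_
    have : genPlus hA B C x = -(genMinus hA B C x) :=
      neg_smul Complex.I ((opH hA + opBhat hA B + opV hA C ∘ₗ (energyDomain hA).subtype) x)
    rw [this, neg_inj]
  intro ξ η
  rw [hneg, isWaveGenerator_genPlus hA hC]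
  refine exists_congr fun x => exists_congr fun z => and_congr_right fun _ =>
    and_congr_right fun _ => and_congr ?_ ?_
  · change -(FormDomain.toDomain hA η.fst) = _ ↔ _
    rw [one_smul, neg_inj, neg_one_smul, neg_neg]
  · change -η.snd = _ ↔ _
    rw [one_smul, neg_one_smul, neg_eq_iff_eq_neg]

end Generators

section Estimates

variable {hA} {B : (sqrtOp hA).domain →ₗ[ℂ] X} {σ : ℝ}
  {G : EnergySpace hA →ₗ.[ℂ] EnergySpace hA}

theorem EnergySpace.norm_sq_eq (ξ : EnergySpace hA) :
    ‖ξ‖ ^ 2 = ‖ξ.fst‖ ^ 2 + ‖ξ.snd‖ ^ 2 :=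
  WithLp.prod_norm_sq_eq_of_L2 ξ

theorem EnergySpace.norm_snd_le (ξ : EnergySpace hA) : ‖ξ.snd‖ ≤ ‖ξ‖ := by
  refine le_of_sq_le_sq ?_ (norm_nonneg ξ)
  rw [EnergySpace.norm_sq_eq]
  exact le_add_of_nonneg_left (sq_nonneg _)

theorem EnergySpace.norm_fst_le (ξ : EnergySpace hA) : ‖ξ.fst‖ ≤ ‖ξ‖ := by
  refine le_of_sq_le_sq ?_ (norm_nonneg ξ)
  rw [EnergySpace.norm_sq_eq]
  exact le_add_of_nonneg_right (sq_nonneg _)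

/-- The contributions of `A` from the two components have opposite real parts. The `ε` term is kept
as a product of first components because it is then exactly what differentiating `ε ‖ξ₁‖²` produces.
-/
theorem IsWaveGenerator.re_inner_eq (hG : IsWaveGenerator hA B σ G) {ξ η : EnergySpace hA}
    (h : (ξ, η) ∈ G.graph) : ∃ z : (sqrtOp hA).domain, ξ.snd = z ∧
      FormDomain.incl hA η.fst = -(σ • (z : X)) ∧
      (inner ℂ ξ η).re = ε * (inner ℂ (FormDomain.incl hA ξ.fst) (FormDomain.incl hA η.fst)).re +
        σ * (inner ℂ (z : X) (Complex.I • B z)).re := by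
  obtain ⟨x, z, h1, h2, h3, h4⟩ := (hG ξ η).mp h
  have h5 : FormDomain.incl hA η.fst = -(σ • (z : X)) := congrArg Subtype.val h3
  refine ⟨z, h2, h5, ?_⟩
  have h6 : FormDomain.incl hA ξ.fst = x := congrArg Subtype.val h1
  rw [EnergySpace.inner_eq, h1, inner_sqrtOp_sqrtOp, ← FormDomain.incl_apply, h5, h6, h2, h4]
  have hsym : (inner ℂ (z : X) (A x)).re = (inner ℂ (A x) (z : X)).re := by
    rw [← inner_conj_symm, Complex.conj_re]
  have hsym' : (inner ℂ (z : X) (x : X)).re = (inner ℂ (x : X) (z : X)).re := by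
    rw [← inner_conj_symm, Complex.conj_re]
  simp only [← Complex.coe_smul, inner_neg_right, inner_smul_right, inner_add_right,
    inner_sub_right, Complex.add_re, Complex.neg_re, Complex.sub_re, Complex.re_ofReal_mul, hsym,
    hsym']
  ring

/-- Accretivity of `G + μ_B + √ε`: since `√ε ‖ξ₁‖ ≤ |ξ|`, the `ε` term costs at most `√ε |ξ|²`. -/
theorem IsWaveGenerator.norm_le (hG : IsWaveGenerator hA B σ G) (hσ : |σ| = 1)
    (hB : IsSymmetricOn B ∨ IsBoundedOn B) {ξ η : EnergySpace hA} (h : (ξ, η) ∈ G.graph) {k : ℝ} :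
    k * ‖ξ‖ ≤ ‖k • ξ + (η + (muB B + √ε) • ξ)‖ := by
  obtain ⟨z, h1, h2, h3⟩ := hG.re_inner_eq h
  have hε := hA.eps_pos
  have h4 : |σ * (inner ℂ (z : X) (Complex.I • B z)).re| ≤ muB B * ‖ξ‖ ^ 2 := by
    rw [abs_mul, hσ, one_mul]
    refine (abs_re_inner_le_muB hB z).trans (mul_le_mul_of_nonneg_left ?_ (muB_nonneg B))
    rw [← h1]
    exact pow_le_pow_left₀ (norm_nonneg _) (EnergySpace.norm_snd_le ξ) 2
  have h5 : |(inner ℂ (FormDomain.incl hA ξ.fst) (FormDomain.incl hA η.fst)).re| ≤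
      ‖FormDomain.incl hA ξ.fst‖ * ‖ξ‖ := by
    refine (Complex.abs_re_le_norm _).trans ((norm_inner_le_norm _ _).trans ?_)
    refine mul_le_mul_of_nonneg_left ?_ (norm_nonneg _)
    rw [h2, norm_neg, norm_smul, Real.norm_eq_abs, hσ, one_mul, ← h1]
    exact EnergySpace.norm_snd_le ξ
  have h6 : √ε * ‖FormDomain.incl hA ξ.fst‖ ≤ ‖ξ‖ := by
    refine le_trans (le_of_sq_le_sq ?_ (norm_nonneg _)) (EnergySpace.norm_fst_le ξ)
    rw [mul_pow, Real.sq_sqrt hε.le]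
    exact FormDomain.norm_incl_sq_le hA _
  have h7 : ε * (‖FormDomain.incl hA ξ.fst‖ * ‖ξ‖) ≤ √ε * ‖ξ‖ ^ 2 := by
    calc ε * (‖FormDomain.incl hA ξ.fst‖ * ‖ξ‖)
        = √ε * ((√ε * ‖FormDomain.incl hA ξ.fst‖) * ‖ξ‖) := by
          nth_rewrite 1 [← Real.mul_self_sqrt hε.le]
          ring
      _ ≤ √ε * (‖ξ‖ * ‖ξ‖) := by gcongr
      _ = _ := by ring
  have h8 : -((√ε + muB B) * ‖ξ‖ ^ 2) ≤ (inner ℂ ξ η).re := by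
    rw [h3]
    have h9 := mul_le_mul_of_nonneg_left (abs_le.mp h5).1 hε.le
    have h10 := (abs_le.mp h4).1
    linarith
  have h9 : k * ‖ξ‖ ^ 2 ≤ (inner ℂ ξ (k • ξ + (η + (muB B + √ε) • ξ))).re := by
    have hself : (inner ℂ ξ ξ).re = ‖ξ‖ ^ 2 := inner_self_eq_norm_sq (𝕜 := ℂ) ξ
    simp only [← Complex.coe_smul, inner_smul_right, inner_add_right, Complex.add_re,
      Complex.re_ofReal_mul, hself]
    linarith
  have h10 := h9.trans ((Complex.re_le_norm _).trans (norm_inner_le_norm _ _))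
  rcases (norm_nonneg ξ).eq_or_lt with h0 | h0
  · rw [← h0, mul_zero]
    exact norm_nonneg _
  · refine le_of_mul_le_mul_left ?_ h0
    linarith

end Estimates

section Range

variable {hA} {B : (sqrtOp hA).domain →ₗ[ℂ] X}

/-- The cross term `2 k² ‖A^{1/2} x‖²` is what absorbs `k B`. -/
theorem IsStrictlyPositiveSA.norm_add_smul_sq (k : ℝ) (x : A.domain) :
    ‖A x + k ^ 2 • (x : X)‖ ^ 2 =
      ‖A x‖ ^ 2 + 2 * k ^ 2 * ‖sqrtOp hA (inclDomain hA x)‖ ^ 2 + k ^ 4 * ‖(x : X)‖ ^ 2 := by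
  have h1 : (inner ℂ (A x) (x : X)).re = ‖sqrtOp hA (inclDomain hA x)‖ ^ 2 := by
    rw [← inner_self_eq_norm_sq (𝕜 := ℂ), inner_sqrtOp_sqrtOp]
    rfl
  rw [norm_add_sq (𝕜 := ℂ), ← Complex.coe_smul, inner_smul_right, norm_smul, Complex.norm_real,
    Real.norm_eq_abs, mul_pow, sq_abs]
  change _ + 2 * (((k ^ 2 : ℝ) : ℂ) * _).re + _ = _
  rw [Complex.re_ofReal_mul, h1]
  ring

/-- Relative to `A + k²` the perturbation has norm at most `3/4 + 1/8 = 7/8`, so a Neumann series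
inverts the sum. -/
theorem exists_add_eq {a b : ℝ} (ha_nonneg : 0 ≤ a) (ha_lt : a < 1)
    (hB : ∀ ξ : (sqrtOp hA).domain,
      ‖B ξ‖ ^ 2 ≤ a ^ 2 * ‖sqrtOp hA ξ‖ ^ 2 + b ^ 2 * ‖(ξ : X)‖ ^ 2)
    {k : ℝ} (hk : 1 + 2 * b ^ 2 + 8 * ε ≤ k) {σ : ℝ} (hσ : |σ| = 1) (y : X) :
    ∃ x : A.domain,
      A x + k ^ 2 • (x : X) + (Complex.I • (σ * k) • B (inclDomain hA x) - ε • (x : X)) = y := by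
  have hε := hA.eps_pos
  have hk1 : 1 ≤ k := by nlinarith [sq_nonneg b]
  have hk2 : k ≤ k ^ 2 := by nlinarith
  have hP := hA.addConst (sq_nonneg k)
  let e : A.domain ≃ₗ[ℂ] X := LinearEquiv.ofBijective (addConst A (k ^ 2)).toFun
    ⟨hP.injective, hP.surjective⟩
  have he : ∀ x : A.domain, e x = A x + k ^ 2 • (x : X) := fun x => by
    rw [← Complex.coe_smul]
    rfl
  let K₀ : A.domain →ₗ[ℂ] X :=
    Complex.I • (σ * k) • B ∘ₗ inclDomain hA - ε • A.domain.subtype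
  have hK₀ : ∀ x, K₀ x = Complex.I • (σ * k) • B (inclDomain hA x) - ε • (x : X) := fun x => rfl
  have hbound : ∀ x, ‖K₀ x‖ ≤ 7 / 8 * ‖e x‖ := fun x => by
    have h1 := IsStrictlyPositiveSA.norm_add_smul_sq (hA := hA) k x
    rw [← he] at h1
    have h2 := hB (inclDomain hA x)
    change _ ≤ _ + b ^ 2 * ‖(x : X)‖ ^ 2 at h2
    set s := ‖sqrtOp hA (inclDomain hA x)‖ ^ 2
    have hs : 0 ≤ s := sq_nonneg _
    have hx : 0 ≤ ‖(x : X)‖ ^ 2 := sq_nonneg _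
    have ha2 : a ^ 2 ≤ 1 := by nlinarith
    -- From `a² ≤ 1` and `2 b² ≤ k ≤ k²`, the square of the left side is at most half of `‖e x‖²`,
    -- and `1/2 ≤ 9/16`.
    have h3 : k * ‖B (inclDomain hA x)‖ ≤ 3 / 4 * ‖e x‖ := by
      refine le_of_sq_le_sq ?_ (by positivity)
      rw [mul_pow, mul_pow, h1]
      have h4 : k ^ 2 * ‖B (inclDomain hA x)‖ ^ 2 ≤ k ^ 2 * (s + b ^ 2 * ‖(x : X)‖ ^ 2) := by
        refine mul_le_mul_of_nonneg_left (h2.trans ?_) (sq_nonneg k)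
        nlinarith
      have h5 : k ^ 2 * (b ^ 2 * ‖(x : X)‖ ^ 2) ≤ k ^ 2 * (k ^ 2 / 2 * ‖(x : X)‖ ^ 2) := by
        gcongr
        linarith
      nlinarith [mul_nonneg (sq_nonneg k) hs, mul_nonneg (sq_nonneg (k ^ 2)) hx, sq_nonneg ‖A x‖]
    have h6 : ε * ‖(x : X)‖ ≤ 1 / 8 * ‖e x‖ := by
      have h7 : k ^ 2 * ‖(x : X)‖ ≤ ‖e x‖ := by
        refine le_of_sq_le_sq ?_ (norm_nonneg _)
        rw [h1]
        nlinarith [mul_nonneg (sq_nonneg k) hs, sq_nonneg ‖A x‖]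
      nlinarith [norm_nonneg (x : X), sq_nonneg b]
    rw [hK₀]
    refine (norm_sub_le _ _).trans ?_
    rw [norm_smul, norm_smul, norm_smul, Complex.norm_I, Real.norm_eq_abs, Real.norm_eq_abs,
      abs_mul, hσ, one_mul, one_mul, abs_of_pos hε, abs_of_nonneg (zero_le_one.trans hk1)]
    linarith
  let K : X →L[ℂ] X := (K₀ ∘ₗ e.symm.toLinearMap).mkContinuous (7 / 8) fun y => by
    simpa using hbound (e.symm y)
  have hK : ‖-K‖ < 1 := by
    rw [norm_neg]
    exact (LinearMap.mkContinuous_norm_le _ (by norm_num) _).trans_lt (by norm_num)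
  let u := Units.oneSub (-K) hK
  have hu : ∀ y, (u⁻¹.val : X →L[ℂ] X) y + K ((u⁻¹.val : X →L[ℂ] X) y) = y := fun y => by
    have h1 : (u.val * u⁻¹.val : X →L[ℂ] X) y = y := by
      rw [Units.mul_inv]
      rfl
    have h2 : u.val = 1 + K := by
      change 1 - -K = _
      rw [sub_neg_eq_add]
    rw [h2] at h1
    exact h1
  refine ⟨e.symm ((u⁻¹.val : X →L[ℂ] X) y), ?_⟩
  rw [← he, ← hK₀, e.apply_symm_apply]
  exact hu y

variable {σ : ℝ} {G : EnergySpace hA →ₗ.[ℂ] EnergySpace hA}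

theorem IsWaveGenerator.exists_mem_graph (hG : IsWaveGenerator hA B σ G) (hσ : σ * σ = 1)
    {a b : ℝ} (ha_nonneg : 0 ≤ a) (ha_lt : a < 1)
    (hB : ∀ ξ : (sqrtOp hA).domain,
      ‖B ξ‖ ^ 2 ≤ a ^ 2 * ‖sqrtOp hA ξ‖ ^ 2 + b ^ 2 * ‖(ξ : X)‖ ^ 2)
    {k : ℝ} (hk : 1 + 2 * b ^ 2 + 8 * ε ≤ k) (ζ : EnergySpace hA) :
    ∃ ξ η, (ξ, η) ∈ G.graph ∧ k • ξ + η = ζ := by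
  have hσ' : |σ| = 1 := by
    rcases mul_self_eq_one_iff.mp hσ with h | h <;> simp [h]
  set v := FormDomain.toDomain hA ζ.fst
  -- The first component of the equation forces `ξ₂ = σ (k ξ₁ - ζ₁)`. Substituting this in the
  -- second and multiplying by `σ` leaves the present equation for `x = ξ₁`.
  obtain ⟨x, hx⟩ := exists_add_eq ha_nonneg ha_lt hB hk hσ'
    (σ • ζ.snd + Complex.I • σ • B v + k • (v : X))
  set z : (sqrtOp hA).domain := σ • (k • inclDomain hA x - v) with hz
  refine ⟨WithLp.toLp 2 ((FormDomain.toDomain hA).symm (inclDomain hA x), (z : X)),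
    WithLp.toLp 2 ((FormDomain.toDomain hA).symm (-(σ • z)),
      σ • (A x + Complex.I • B z - ε • (x : X))), (hG _ _).mpr ⟨x, z, rfl, rfl, rfl, rfl⟩, ?_⟩
  refine WithLp.ofLp_injective 2 (Prod.ext ((FormDomain.toDomain hA).injective ?_) ?_)
  · change k • inclDomain hA x + -(σ • z) = v
    rw [hz, smul_smul, hσ, one_smul]
    abel
  · change k • (z : X) + σ • (A x + Complex.I • B z - ε • (x : X)) = ζ.snd
    have hzc : (z : X) = σ • (k • (x : X) - (v : X)) := rfl
    have hBz : B z = σ • (k • B (inclDomain hA x) - B v) := by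
      rw [hz, LinearMap.map_smul_of_tower, map_sub, LinearMap.map_smul_of_tower]
    have h1 : ζ.snd = σ • (σ • ζ.snd) := by rw [smul_smul, hσ, one_smul]
    have h2 : σ • ζ.snd = A x + k ^ 2 • (x : X) +
        (Complex.I • (σ * k) • B (inclDomain hA x) - ε • (x : X)) -
          (Complex.I • σ • B v + k • (v : X)) := by
      rw [hx]
      abel
    rw [h1, h2, hzc, hBz]
    simp only [smul_sub, smul_add, smul_comm Complex.I, smul_smul]
    module

/-- The wave operators generate strongly continuous semigroups. -/
theorem IsWaveGenerator.exists_isSemigroupGeneratedBy (hG : IsWaveGenerator hA B σ G)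
    (hσ : σ * σ = 1) (hdom : G.domain = energyDomain hA)
    (hBc : IsSymmetricOn B ∨ IsBoundedOn B) {a b : ℝ} (ha_nonneg : 0 ≤ a) (ha_lt : a < 1)
    (hB : ∀ ξ : (sqrtOp hA).domain,
      ‖B ξ‖ ^ 2 ≤ a ^ 2 * ‖sqrtOp hA ξ‖ ^ 2 + b ^ 2 * ‖(ξ : X)‖ ^ 2) :
    ∃ T, IsSemigroupGeneratedBy T G := by
  have hσ' : |σ| = 1 := by
    rcases mul_self_eq_one_iff.mp hσ with h | h <;> simp [h]
  obtain ⟨w, hw⟩ : ∃ w, w = muB B + √ε := ⟨_, rfl⟩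
  have hw0 : 0 ≤ w := hw ▸ add_nonneg (muB_nonneg B) (Real.sqrt_nonneg ε)
  have hε := hA.eps_pos
  have hgraph := mem_graph_addConst_iff G w
  have hκ : 0 < 1 + 2 * b ^ 2 + 8 * ε := by positivity
  have hd : Dense ((addConst G w).domain : Set (EnergySpace hA)) := by
    change Dense (G.domain : Set (EnergySpace hA))
    rw [hdom]
    exact dense_energyDomain hA
  obtain ⟨T, hT⟩ := exists_isSemigroupGeneratedBy_of_contractiveResolvent hd hκ fun k hk => by
    refine exists_isContractiveResolvent (hκ.trans_le hk) (fun x y hxy => ?_) fun z => ?_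
    · have h1 : (x, y - w • x) ∈ G.graph := by
        rw [hgraph, sub_add_cancel]
        exact hxy
      have h2 := hG.norm_le hσ' hBc h1 (k := k)
      rwa [← hw, sub_add_cancel] at h2
    -- The range condition for `G + w` at `k` is that for `G` at `k + w`.
    · obtain ⟨x, y, hxy, heq⟩ := hG.exists_mem_graph hσ ha_nonneg ha_lt hB
        (hk.trans (le_add_of_nonneg_right hw0)) z
      refine ⟨x, y + w • x, (hgraph _ _).mp hxy, ?_⟩
      rw [← heq, add_smul]
      abel
  exact ⟨_, hT.exp_smul hgraph⟩

end Range

end WaveGenerator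

/-! ### Differentiability of orbits -/

section SemigroupDeriv

variable {E : Type*} [NormedAddCommGroup E] [NormedSpace ℂ E] {T : ℝ≥0 → E →L[ℂ] E}
  {G : E →ₗ.[ℂ] E}

theorem IsSemigroupGeneratedBy.map_mem_graph (h : IsSemigroupGeneratedBy T G) {x y : E}
    (hxy : (x, y) ∈ G.graph) (t : ℝ≥0) : (T t x, T t y) ∈ G.graph := by
  rw [h.generator] at hxy ⊢
  refine (((T t).continuous.tendsto y).comp hxy).congr fun s => ?_
  have h1 : T t (T s x) = T s (T t x) := by
    change (T t * T s) x = (T s * T t) x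
    rw [← h.map_add, ← h.map_add, add_comm]
  rw [Function.comp_apply, map_smul, map_sub, h1]

/-- The generator is a limit from the right, so the right derivative comes directly; Grönwall and
the mean value inequality need no more. -/
theorem IsSemigroupGeneratedBy.hasDerivWithinAt (h : IsSemigroupGeneratedBy T G) {x y : E}
    (hxy : (x, y) ∈ G.graph) {s : ℝ} (hs : 0 ≤ s) :
    HasDerivWithinAt (fun s : ℝ => T s.toNNReal x) (-(T s.toNNReal y)) (Ici s) s := by
  rw [← hasDerivWithinAt_Ioi_iff_Ici, hasDerivWithinAt_iff_tendsto_slope' self_notMem_Ioi]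
  have h1 := ((h.generator _ _).mp (h.map_mem_graph hxy s.toNNReal)).neg
  have h2 : Tendsto (fun r : ℝ => (r - s).toNNReal) (𝓝[>] s) (𝓝[>] 0) := by
    refine tendsto_nhdsWithin_iff.mpr ⟨?_, ?_⟩
    · have hc : Continuous fun r : ℝ => (r - s).toNNReal := by fun_prop
      have := hc.tendsto s
      rw [sub_self, Real.toNNReal_zero] at this
      exact this.mono_left nhdsWithin_le_nhds
    · filter_upwards [self_mem_nhdsWithin] with r hr
      exact Real.toNNReal_pos.mpr (sub_pos.mpr hr)
  refine (h1.comp h2).congr' ?_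
  filter_upwards [self_mem_nhdsWithin] with r hr
  have hrs : 0 ≤ r - s := (sub_pos.mpr hr).le
  have h3 : r.toNNReal = (r - s).toNNReal + s.toNNReal := by
    rw [← Real.toNNReal_add hrs hs, sub_add_cancel]
  rw [Function.comp_apply, slope_def_module, h3, h.map_add, Real.coe_toNNReal _ hrs,
    Complex.coe_smul, ← smul_neg, neg_sub]
  rfl

theorem IsSemigroupGeneratedBy.continuous_toNNReal (h : IsSemigroupGeneratedBy T G) (x : E) :
    Continuous fun s : ℝ => T s.toNNReal x :=
  (h.continuous x).comp continuous_real_toNNReal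

end SemigroupDeriv

theorem hasDerivWithinAt_norm_sq {E : Type*} [NormedAddCommGroup E] [InnerProductSpace ℂ E]
    {f : ℝ → E} {f' : E} {s : Set ℝ} {x : ℝ} (hf : HasDerivWithinAt f f' s x) :
    HasDerivWithinAt (fun t => ‖f t‖ ^ 2) (2 * (inner ℂ (f x) f').re) s x := by
  let : InnerProductSpace ℝ E := InnerProductSpace.rclikeToReal ℂ E
  have h := HasDerivWithinAt.norm_sq hf
  rwa [real_inner_eq_re_inner ℂ] at h

/-! ### Growth of the semigroup -/

section Growth

variable {X : Type*} [NormedAddCommGroup X] [InnerProductSpace ℂ X] [CompleteSpace X]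
  {A : X →ₗ.[ℂ] X} {ε : ℝ} {hA : IsStrictlyPositiveSA A ε}
  {B : (sqrtOp hA).domain →ₗ[ℂ] X} {σ : ℝ} {G : EnergySpace hA →ₗ.[ℂ] EnergySpace hA}
  {T : ℝ≥0 → EnergySpace hA →L[ℂ] EnergySpace hA}

/-- The map `ξ ↦ ξ₁` from the energy space into `X`. -/
def EnergySpace.fstX (hA : IsStrictlyPositiveSA A ε) : EnergySpace hA →L[ℂ] X :=
  FormDomain.incl hA ∘L WithLp.fstL 2 ℂ (FormDomain hA) X

theorem EnergySpace.fstX_apply (ξ : EnergySpace hA) :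
    EnergySpace.fstX hA ξ = FormDomain.incl hA ξ.fst := rfl

/-- The reduced energy `⟨ξ₁, (A - ε) ξ₁⟩ + ‖ξ₂‖²`. -/
def reducedEnergy (ξ : EnergySpace hA) : ℝ := ‖ξ‖ ^ 2 - ε * ‖EnergySpace.fstX hA ξ‖ ^ 2

theorem norm_snd_sq_le_reducedEnergy (ξ : EnergySpace hA) : ‖ξ.snd‖ ^ 2 ≤ reducedEnergy ξ := by
  rw [reducedEnergy, EnergySpace.norm_sq_eq, EnergySpace.fstX_apply]
  have := FormDomain.norm_incl_sq_le hA ξ.fst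
  linarith

theorem reducedEnergy_nonneg (ξ : EnergySpace hA) : 0 ≤ reducedEnergy ξ :=
  (sq_nonneg _).trans (norm_snd_sq_le_reducedEnergy ξ)

/-- Subtracting `ε ‖ξ₁‖²` removes the `ε` term of `re_inner_eq` from the derivative. The remaining
`B` term is at most `2 μ_B ‖ξ₂‖²`, hence at most `2 μ_B` times the reduced energy, and Grönwall
applies. -/
theorem IsWaveGenerator.reducedEnergy_le (hG : IsWaveGenerator hA B σ G) (hσ : |σ| = 1)
    (hB : IsSymmetricOn B ∨ IsBoundedOn B) (hT : IsSemigroupGeneratedBy T G)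
    {ξ η : EnergySpace hA} (h : (ξ, η) ∈ G.graph) (t : ℝ≥0) :
    reducedEnergy (T t ξ) ≤ reducedEnergy ξ * Real.exp (2 * muB B * t) := by
  have hd : ∀ s : ℝ, 0 ≤ s → HasDerivWithinAt (fun s : ℝ => reducedEnergy (T s.toNNReal ξ))
      (2 * (inner ℂ (T s.toNNReal ξ) (-(T s.toNNReal η))).re -
        ε * (2 * (inner ℂ (EnergySpace.fstX hA (T s.toNNReal ξ))
          (EnergySpace.fstX hA (-(T s.toNNReal η)))).re)) (Ici s) s := fun s hs => by
    have h1 := hT.hasDerivWithinAt h hs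
    have h2 := (((EnergySpace.fstX hA).restrictScalars ℝ).hasFDerivAt
      (x := T s.toNNReal ξ)).comp_hasDerivWithinAt s h1
    exact (hasDerivWithinAt_norm_sq h1).sub ((hasDerivWithinAt_norm_sq h2).const_mul ε)
  have hc : Continuous fun s : ℝ => reducedEnergy (T s.toNNReal ξ) := by
    have h1 := hT.continuous_toNNReal ξ
    have h2 := (EnergySpace.fstX hA).continuous.comp h1
    exact (h1.norm.pow 2).sub ((h2.norm.pow 2).const_mul ε)
  have hg := le_gronwallBound_of_liminf_deriv_right_le
    (f := fun s : ℝ => reducedEnergy (T s.toNNReal ξ)) (δ := reducedEnergy ξ)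
    (K := 2 * muB B) (ε := 0) (a := 0) (b := t) hc.continuousOn
    (fun s hs r hr => (hd s hs.1).liminf_right_slope_le hr)
    (by rw [Real.toNNReal_zero, hT.map_zero]; rfl)
    (fun s hs => by
      obtain ⟨z, h1, -, h3⟩ := hG.re_inner_eq (hT.map_mem_graph h s.toNNReal)
      have h4 : |σ * (inner ℂ (z : X) (Complex.I • B z)).re| ≤
          muB B * reducedEnergy (T s.toNNReal ξ) := by
        rw [abs_mul, hσ, one_mul]
        refine (abs_re_inner_le_muB hB z).trans (mul_le_mul_of_nonneg_left ?_ (muB_nonneg B))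
        rw [← h1]
        exact norm_snd_sq_le_reducedEnergy _
      have h5 := (abs_le.mp h4).1
      rw [map_neg, inner_neg_right, inner_neg_right, Complex.neg_re, Complex.neg_re, h3,
        EnergySpace.fstX_apply, EnergySpace.fstX_apply]
      linarith) t ⟨t.2, le_rfl⟩
  rwa [gronwallBound_ε0, sub_zero, Real.toNNReal_coe] at hg

/-- The velocity of the first component has norm `‖ξ₂‖`, which the reduced energy bounds uniformly
on `[0, t]`. -/
theorem IsWaveGenerator.norm_fstX_le (hG : IsWaveGenerator hA B σ G) (hσ : |σ| = 1)
    (hB : IsSymmetricOn B ∨ IsBoundedOn B) (hT : IsSemigroupGeneratedBy T G)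
    {ξ η : EnergySpace hA} (h : (ξ, η) ∈ G.graph) (t : ℝ≥0) :
    ‖EnergySpace.fstX hA (T t ξ)‖ ≤
      ‖EnergySpace.fstX hA ξ‖ + √(reducedEnergy ξ) * Real.exp (muB B * t) * t := by
  have hd : ∀ s : ℝ, 0 ≤ s → HasDerivWithinAt
      (fun s : ℝ => EnergySpace.fstX hA (T s.toNNReal ξ))
      (EnergySpace.fstX hA (-(T s.toNNReal η))) (Ici s) s := fun s hs => by
    have h1 := (((EnergySpace.fstX hA).restrictScalars ℝ).hasFDerivAt
      (x := T s.toNNReal ξ)).comp_hasDerivWithinAt s (hT.hasDerivWithinAt h hs)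
    exact h1
  have hc : Continuous fun s : ℝ => EnergySpace.fstX hA (T s.toNNReal ξ) :=
    (EnergySpace.fstX hA).continuous.comp (hT.continuous_toNNReal ξ)
  have hb := norm_image_sub_le_of_norm_deriv_right_le_segment (a := 0) (b := t)
    (C := √(reducedEnergy ξ) * Real.exp (muB B * t)) hc.continuousOn (fun s hs => hd s hs.1)
    (fun s hs => by
      obtain ⟨z, h1, h2, -⟩ := hG.re_inner_eq (hT.map_mem_graph h s.toNNReal)
      have h3 := hG.reducedEnergy_le hσ hB hT h s.toNNReal
      rw [Real.coe_toNNReal _ hs.1] at h3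
      rw [map_neg, EnergySpace.fstX_apply, h2, norm_neg, norm_neg, norm_smul, Real.norm_eq_abs,
        hσ, one_mul, ← h1]
      refine le_of_sq_le_sq ?_ (by positivity)
      rw [mul_pow, Real.sq_sqrt (reducedEnergy_nonneg ξ), ← Real.exp_nat_mul]
      refine (norm_snd_sq_le_reducedEnergy _).trans (h3.trans ?_)
      refine mul_le_mul_of_nonneg_left (Real.exp_le_exp.mpr ?_) (reducedEnergy_nonneg ξ)
      have h4 := mul_le_mul_of_nonneg_left hs.2.le (muB_nonneg B)
      push_cast
      linarith) t ⟨t.2, le_rfl⟩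
  rw [Real.toNNReal_zero, hT.map_zero, Real.toNNReal_coe, sub_zero] at hb
  have h1 := norm_le_norm_add_norm_sub' (EnergySpace.fstX hA (T t ξ)) (EnergySpace.fstX hA ξ)
  change ‖EnergySpace.fstX hA (T t ξ) - EnergySpace.fstX hA ξ‖ ≤ _ at hb
  linarith

/-- With `p² = E(0)`, `q = √ε ‖ξ₁‖`, `τ = √ε t` and `m = exp (μ_B t)`, the two previous bounds give
`|T(t) ξ|² ≤ m² (p² + (q + p τ)²)`, while `|ξ|² = p² + q²`. -/
theorem IsWaveGenerator.norm_apply_le (hG : IsWaveGenerator hA B σ G) (hσ : |σ| = 1)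
    (hB : IsSymmetricOn B ∨ IsBoundedOn B) (hT : IsSemigroupGeneratedBy T G)
    {ξ η : EnergySpace hA} (h : (ξ, η) ∈ G.graph) {t : ℝ≥0} (ht : 1 ≤ √ε * t) :
    ‖T t ξ‖ ≤ Real.exp 1 * √ε * t * Real.exp (muB B * t) * ‖ξ‖ := by
  have hε := hA.eps_pos
  have h1 := hG.reducedEnergy_le hσ hB hT h t
  have h2 := hG.norm_fstX_le hσ hB hT h t
  set m := Real.exp (muB B * t) with hm
  have hm1 : 1 ≤ m := Real.one_le_exp (mul_nonneg (muB_nonneg B) t.2)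
  have hm2 : Real.exp (2 * muB B * t) = m ^ 2 := by
    rw [hm, ← Real.exp_nat_mul]
    push_cast
    ring_nf
  rw [hm2] at h1
  set p := √(reducedEnergy ξ) with hp
  have hp0 : 0 ≤ p := Real.sqrt_nonneg _
  have hp2 : reducedEnergy ξ = p ^ 2 := (Real.sq_sqrt (reducedEnergy_nonneg ξ)).symm
  rw [hp2] at h1
  set q := √ε * ‖EnergySpace.fstX hA ξ‖ with hq
  have hq0 : 0 ≤ q := by positivity
  have hq2 : q ^ 2 = ε * ‖EnergySpace.fstX hA ξ‖ ^ 2 := by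
    rw [hq, mul_pow, Real.sq_sqrt hε.le]
  have hnorm : ‖ξ‖ ^ 2 = p ^ 2 + q ^ 2 := by
    rw [← hp2, hq2, reducedEnergy, sub_add_cancel]
  set τ := √ε * t with hτ
  have h3 : √ε * ‖EnergySpace.fstX hA (T t ξ)‖ ≤ m * (q + p * τ) := by
    calc √ε * ‖EnergySpace.fstX hA (T t ξ)‖
        ≤ √ε * (‖EnergySpace.fstX hA ξ‖ + p * m * t) := by gcongr
      _ = 1 * q + m * (p * τ) := by
          rw [hq, hτ]
          ring
      _ ≤ m * q + m * (p * τ) := by gcongr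
      _ = _ := by ring
  have h4 : ε * ‖EnergySpace.fstX hA (T t ξ)‖ ^ 2 ≤ m ^ 2 * (q + p * τ) ^ 2 := by
    have := pow_le_pow_left₀ (by positivity) h3 2
    rwa [mul_pow, mul_pow, Real.sq_sqrt hε.le] at this
  have h5 : ‖T t ξ‖ ^ 2 ≤ m ^ 2 * (p ^ 2 + (q + p * τ) ^ 2) := by
    have : ‖T t ξ‖ ^ 2 = reducedEnergy (T t ξ) + ε * ‖EnergySpace.fstX hA (T t ξ)‖ ^ 2 := by
      rw [reducedEnergy, sub_add_cancel]
    rw [this]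
    linarith
  have hτ1 : 1 ≤ τ ^ 2 := one_le_pow₀ ht
  -- Use `(q + p τ)² ≤ 2 q² + 2 p² τ²` and `τ ≥ 1`. The resulting factor `√3` is below `e`.
  have h6 : p ^ 2 + (q + p * τ) ^ 2 ≤ 3 * (τ ^ 2 * (p ^ 2 + q ^ 2)) := by
    nlinarith [sq_nonneg (q - p * τ), mul_nonneg (sub_nonneg.mpr hτ1) (sq_nonneg p),
      mul_nonneg (sub_nonneg.mpr hτ1) (sq_nonneg q), sq_nonneg q]
  have he : (3 : ℝ) ≤ Real.exp 1 ^ 2 := by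
    have := Real.exp_one_gt_d9
    nlinarith
  refine le_of_sq_le_sq ?_ (by positivity)
  calc ‖T t ξ‖ ^ 2 ≤ m ^ 2 * (3 * (τ ^ 2 * (p ^ 2 + q ^ 2))) :=
        h5.trans (mul_le_mul_of_nonneg_left h6 (sq_nonneg m))
    _ ≤ m ^ 2 * (Real.exp 1 ^ 2 * (τ ^ 2 * (p ^ 2 + q ^ 2))) := by gcongr
    _ = m ^ 2 * (Real.exp 1 ^ 2 * (τ ^ 2 * ‖ξ‖ ^ 2)) := by rw [hnorm]
    _ = _ := by
        rw [hτ]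
        ring

theorem IsWaveGenerator.opNorm_le (hG : IsWaveGenerator hA B σ G) (hσ : |σ| = 1)
    (hdom : G.domain = energyDomain hA) (hB : IsSymmetricOn B ∨ IsBoundedOn B)
    (hT : IsSemigroupGeneratedBy T G) {t : ℝ≥0} (ht : 1 ≤ √ε * t) :
    ‖T t‖ ≤ Real.exp 1 * √ε * t * Real.exp (muB B * t) := by
  refine ContinuousLinearMap.opNorm_le_bound _ (by positivity) fun ξ => ?_
  have hd : Dense (G.domain : Set (EnergySpace hA)) := by
    rw [hdom]
    exact dense_energyDomain hA
  have hcl : IsClosed {ξ | ‖T t ξ‖ ≤ Real.exp 1 * √ε * t * Real.exp (muB B * t) * ‖ξ‖} :=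
    isClosed_le (T t).continuous.norm (continuous_const.mul continuous_norm)
  exact hcl.closure_subset_iff.mpr
    (fun ζ hζ => hG.norm_apply_le hσ hB hT (G.mem_graph ⟨ζ, hζ⟩) ht) (hd ξ)

end Growth

end AbstractWave

end

theorem theorem16 {X : Type*} [NormedAddCommGroup X] [InnerProductSpace ℂ X] [CompleteSpace X]
    (A : X →ₗ.[ℂ] X) (ε : ℝ) (hA : IsStrictlyPositiveSA A ε)
    (A₀ : X →ₗ.[ℂ] X) (hA₀ : IsSelfAdjoint A₀) (hA₀_nonneg : IsNonneg A₀)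
    (hA_eq : A = addConst A₀ ε)
    (B : (sqrtOp hA).domain →ₗ[ℂ] X) (a b : ℝ) (ha_nonneg : 0 ≤ a) (ha_lt : a < 1)
    (hB : ∀ ξ : (sqrtOp hA).domain, ‖B ξ‖ ^ 2 ≤ a ^ 2 * ‖sqrtOp hA ξ‖ ^ 2 + b ^ 2 * ‖(ξ : X)‖ ^ 2)
    (hB_cases : IsSymmetricOn B ∨ IsBoundedOn B)
    (C : (sqrtOp hA).domain →ₗ[ℂ] X)
    (hC : ∀ ξ : (sqrtOp hA).domain, C ξ = -((ε : ℂ) • (ξ : X))) :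
    (∃ T : ℝ≥0 → EnergySpace hA →L[ℂ] EnergySpace hA,
      IsSemigroupGeneratedBy T (genPlus hA B C)) ∧
    (∃ T : ℝ≥0 → EnergySpace hA →L[ℂ] EnergySpace hA,
      IsSemigroupGeneratedBy T (genMinus hA B C)) ∧
    ∀ T : ℝ≥0 → EnergySpace hA →L[ℂ] EnergySpace hA,
      (IsSemigroupGeneratedBy T (genPlus hA B C) ∨
        IsSemigroupGeneratedBy T (genMinus hA B C)) →
      ∀ t : ℝ≥0, ε ^ (-(1 / 2) : ℝ) ≤ (t : ℝ) →
        ‖T t‖ ≤ Real.exp 1 * ε ^ ((1 / 2) : ℝ) * t * Real.exp (muB B * t) := by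
  have hplus := isWaveGenerator_genPlus hA (B := B) hC
  have hminus := isWaveGenerator_genMinus hA (B := B) hC
  refine ⟨hplus.exists_isSemigroupGeneratedBy (by norm_num) rfl hB_cases ha_nonneg ha_lt hB,
    hminus.exists_isSemigroupGeneratedBy (by norm_num) rfl hB_cases ha_nonneg ha_lt hB,
    fun T hT t ht => ?_⟩
  have hε := Real.sqrt_pos.mpr hA.eps_pos
  have ht' : 1 ≤ √ε * t := by
    rw [Real.rpow_neg hA.eps_pos.le, ← Real.sqrt_eq_rpow] at ht
    calc (1 : ℝ) = √ε * (√ε)⁻¹ := (mul_inv_cancel₀ hε.ne').symm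
      _ ≤ √ε * t := mul_le_mul_of_nonneg_left ht hε.le
  rw [← Real.sqrt_eq_rpow]
  rcases hT with hT | hT
  · exact hplus.opNorm_le (by norm_num) rfl hB_cases hT ht'
  · exact hminus.opNorm_le (by norm_num) rfl hB_cases hT ht'
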